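/- Let $A$ and $B$ be (associative, unital) rings, ${}_BM_A$ and ${}_AN_B$ bimodules, $\phi: M\otimes_A N\to B$ a $B$-bimodule map and $\psi: N\otimes_B M\to A$ an $A$-bimodule map such that $$m'\psi(n\otimes m)=\phi(m'\otimes n)m,\qquad n'\phi(m\otimes n)=\psi(n'\otimes m)n$$ for all $m,m'\in M$, $n,n'\in N$. Let $\Lambda=\begin{pmatrix}A&N\\M&B\end{pmatrix}$ be the associated Morita ring, with componentwise addition and multiplication $$\begin{pmatrix}a&n\\m&b\end{pmatrix}\begin{pmatrix}a'&n'\\m'&b'\end{pmatrix}=\begin{pmatrix}aa'+\psi(n\otimes m')&an'+nb'\\ma'+bm'&\phi(m\otimes n')+bb'\end{pmatrix}.$$ Left $\Lambda$-modules are identified (up to isomorphism) with quadruples $(X,Y,f,g)$, where $X\in A\text{-Mod}$, $Y\in B\text{-Mod}$, $f\in\mathrm{Hom}_B(M\otimes_AX,Y)$, $g\in\mathrm{Hom}_A(N\otimes_BY,X)$ satisfy $g(n\otimes f(m\otimes x))=\psi(n\otimes m)x$ and $f(m\otimes g(n\otimes y))=\phi(m\otimes n)y$. Here $\Lambda$ acts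 on columns by $\begin{pmatrix}a&n\\m&b\end{pmatrix}\begin{pmatrix}x\\y\end{pmatrix}=\begin{pmatrix}ax+g(n\otimes y)\\f(m\otimes x)+by\end{pmatrix}$. Write $\tilde f: X\to\mathrm{Hom}_B(M,Y)$ and $\tilde g: Y\to\mathrm{Hom}_A(N,X)$ for the adjoints of $f$ and $g$. For a class $\mathcal C$ of objects of an abelian category, $\mathcal C^\perp$ (resp. ${}^\perp\mathcal C$) is the class of objects $X$ with $\mathrm{Ext}^1(C,X)=0$ (resp. $\mathrm{Ext}^1(X,C)=0$) for all $C\in\mathcal C$. A pair $(\mathcal C,\mathcal D)$ of classes is a cotorsion pair if $\mathcal C^\perp=\mathcal D$ and ${}^\perp\mathcal D=\mathcal C$. It is complete if every object $X$ admits short exact sequences $0\to D_1\to C_1\to X\to0$ and $0\to X\to D_2\to C_2\to 0$ with $C_i\in\mathcal C$, $D_i\in\mathcal D$. It is hereditary if $\mathcal C$ is closed under kernels of epimorphisms and $\mathcal D$ is closed under cokernels of monomorphisms. **Part I.** Assume that $\phi$ is injective. Let $(\mathcal U',\mathcal V')$ and $(\mathcal U'',\mathcal V'')$ be cotorsion pairs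 in $(B/\mathrm{Im}\,\phi)\text{-Mod}$ and $A\text{-Mod}$, respectively, and let $$\mathcal M=\{(X,Y,f,g)\mid B/\mathrm{Im}\,\phi\otimes_B\mathrm{Coker}\,f\in\mathcal U',\ X\in\mathcal U'',\ f\text{ injective}\},$$ $$\mathcal N=\{(X,Y,f,g)\mid B/\mathrm{Im}\,\phi\otimes_B\mathrm{Ker}\,\tilde g\in\mathcal V',\ X\in\mathcal V'',\ \tilde g\text{ surjective}\}.$$ 1. If $\mathrm{Tor}_1^A(M,U)=0$ for all $U\in\mathcal U''$, then $({}^\perp\mathcal N,\mathcal N)$ is a cotorsion pair in $\Lambda\text{-Mod}$. 2. If $\mathrm{Ext}^1_A(N,V)=0$ for all $V\in\mathcal V''$, then $(\mathcal M,\mathcal M^\perp)$ is a cotorsion pair in $\Lambda\text{-Mod}$. 3. If both vanishing conditions hold, then $(\mathcal M,\mathcal N)$ is a cotorsion pair in $\Lambda\text{-Mod}$; and it is complete and hereditary if $(\mathcal U',\mathcal V')$ and $(\mathcal U'',\mathcal V'')$ are both complete and hereditary. **Part II (symmetric version).** Assume that $\psi$ is injective. Let $(\mathcal C',\mathcal D')$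 and $(\mathcal C'',\mathcal D'')$ be cotorsion pairs in $(A/\mathrm{Im}\,\psi)\text{-Mod}$ and $B\text{-Mod}$, respectively, and let $$\mathcal M_*=\{(X,Y,f,g)\mid A/\mathrm{Im}\,\psi\otimes_A\mathrm{Coker}\,g\in\mathcal C',\ Y\in\mathcal C'',\ g\text{ injective}\},$$ $$\mathcal N_*=\{(X,Y,f,g)\mid A/\mathrm{Im}\,\psi\otimes_A\mathrm{Ker}\,\tilde f\in\mathcal D',\ Y\in\mathcal D'',\ \tilde f\text{ surjective}\}.$$ 1. If $\mathrm{Tor}_1^B(N,C)=0$ for all $C\in\mathcal C''$, then $({}^\perp\mathcal N_*,\mathcal N_*)$ is a cotorsion pair in $\Lambda\text{-Mod}$. 2. If $\mathrm{Ext}^1_B(M,D)=0$ for all $D\in\mathcal D''$, then $(\mathcal M_*,\mathcal M_*^\perp)$ is a cotorsion pair in $\Lambda\text{-Mod}$. 3. If both vanishing conditions hold, then $(\mathcal M_*,\mathcal N_*)$ is a cotorsion pair in $\Lambda\text{-Mod}$; and it is complete and hereditary if $(\mathcal C',\mathcal D')$ and $(\mathcal C'',\mathcal D'')$ are both complete and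 hereditary. -/

import Mathlib

open CategoryTheory MulOpposite TensorProduct

universe w v u

/-! ## Cotorsion pairs in an abelian category -/

namespace Cotorsion

/-- The class `𝒞^⊥` of all `X` with `Ext¹(C, X) = 0` for every `C` in `𝒞`. -/
def rightPerp {E : Type u} [Category.{v} E] [Abelian E] [HasExt.{w} E]
    (C : ObjectProperty E) : ObjectProperty E :=
  fun X => ∀ Z : E, C Z → Subsingleton (Abelian.Ext.{w} Z X 1)

/-- The class `^⊥𝒟` of all `X` with `Ext¹(X, D) = 0` for every `D` in `𝒟`. -/
def leftPerp {E : Type u} [Category.{v} E] [Abelian E] [HasExt.{w} E]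
    (D : ObjectProperty E) : ObjectProperty E :=
  fun X => ∀ Z : E, D Z → Subsingleton (Abelian.Ext.{w} X Z 1)

/-- `(𝒞, 𝒟)` is a cotorsion pair: `𝒞^⊥ = 𝒟` and `^⊥𝒟 = 𝒞`. -/
structure IsCotorsionPair {E : Type u} [Category.{v} E] [Abelian E] [HasExt.{w} E]
    (C D : ObjectProperty E) : Prop where
  rightPerp_eq : rightPerp.{w} C = D
  leftPerp_eq : leftPerp.{w} D = C

/-- Every object `X` has short exact sequences `0 → D₁ → C₁ → X → 0` and `0 → X → D₂ → C₂ → 0`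
with `C₁, C₂` in `𝒞` and `D₁, D₂` in `𝒟`. -/
structure IsComplete {E : Type u} [Category.{v} E] [Abelian E]
    (C D : ObjectProperty E) : Prop where
  exists_left : ∀ X : E, ∃ (D₁ C₁ : E) (i : D₁ ⟶ C₁) (p : C₁ ⟶ X) (h : i ≫ p = 0),
    C C₁ ∧ D D₁ ∧ (ShortComplex.mk i p h).ShortExact
  exists_right : ∀ X : E, ∃ (D₂ C₂ : E) (i : X ⟶ D₂) (p : D₂ ⟶ C₂) (h : i ≫ p = 0),
    C C₂ ∧ D D₂ ∧ (ShortComplex.mk i p h).ShortExact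

/-- `𝒞` is closed under kernels of epimorphisms and `𝒟` is closed under cokernels of
monomorphisms. -/
structure IsHereditary {E : Type u} [Category.{v} E] [Abelian E]
    (C D : ObjectProperty E) : Prop where
  kernel_mem : ∀ S : ShortComplex E, S.ShortExact → C S.X₂ → C S.X₃ → C S.X₁
  cokernel_mem : ∀ S : ShortComplex E, S.ShortExact → D S.X₁ → D S.X₂ → D S.X₃

end Cotorsion

/-! ## The tensor product `M ⊗_R X` of a right and a left module over any ring

A right `R`-module is a `Module Rᵐᵒᵖ M`, with `m r` written `op r • m`. -/

section BalTensor

/-- The relations `(m r) ⊗ x = m ⊗ (r x)`, inside `M ⊗_ℤ X`. -/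
def balRel (R M X : Type*) [Ring R] [AddCommGroup M] [Module Rᵐᵒᵖ M]
    [AddCommGroup X] [Module R X] : Submodule ℤ (M ⊗[ℤ] X) :=
  Submodule.span ℤ {t | ∃ (m : M) (r : R) (x : X), t = (op r • m) ⊗ₜ[ℤ] x - m ⊗ₜ[ℤ] (r • x)}

/-- The tensor product `M ⊗_R X` of a right `R`-module `M` and a left `R`-module `X`. -/
def BalTensor (R M X : Type*) [Ring R] [AddCommGroup M] [Module Rᵐᵒᵖ M]
    [AddCommGroup X] [Module R X] : Type _ :=
  (M ⊗[ℤ] X) ⧸ balRel R M X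

namespace BalTensor

variable (R : Type*) {M X : Type*} [Ring R] [AddCommGroup M] [Module Rᵐᵒᵖ M]
  [AddCommGroup X] [Module R X]

instance : AddCommGroup (BalTensor R M X) :=
  inferInstanceAs (AddCommGroup ((M ⊗[ℤ] X) ⧸ balRel R M X))

/-- The pure tensor `m ⊗ x` in `M ⊗_R X`. -/
def tmul (m : M) (x : X) : BalTensor R M X :=
  (balRel R M X).mkQ (m ⊗ₜ[ℤ] x)

theorem tmul_add (m : M) (x y : X) : tmul R m (x + y) = tmul R m x + tmul R m y := by
  simp only [tmul, TensorProduct.tmul_add, map_add]; rfl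

theorem add_tmul (m n : M) (x : X) : tmul R (m + n) x = tmul R m x + tmul R n x := by
  simp only [tmul, TensorProduct.add_tmul, map_add]; rfl

@[simp] theorem tmul_zero (m : M) : tmul R m (0 : X) = 0 := by
  simpa using tmul_add R m (0 : X) 0

@[simp] theorem zero_tmul (x : X) : tmul R (0 : M) x = 0 := by
  simpa using add_tmul R (0 : M) 0 x

theorem smul_tmul (m : M) (r : R) (x : X) : tmul R (op r • m) x = tmul R m (r • x) := by
  refine (Submodule.Quotient.eq _).2 (Submodule.subset_span ⟨m, r, x, rfl⟩)

variable {R}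

@[elab_as_elim]
theorem induction_on {p : BalTensor R M X → Prop} (t : BalTensor R M X)
    (zero : p 0) (tmul : ∀ m x, p (tmul R m x)) (add : ∀ s t, p s → p t → p (s + t)) : p t := by
  obtain ⟨t, rfl⟩ := Submodule.mkQ_surjective (balRel R M X) t
  induction t with
  | zero => exact zero
  | tmul m x => exact tmul m x
  | add s t hs ht => exact add _ _ hs ht

theorem addHom_ext {P : Type*} [AddCommGroup P] {F G : BalTensor R M X →+ P}
    (h : ∀ m x, F (tmul R m x) = G (tmul R m x)) : F = G := by
  ext t
  induction t using induction_on with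
  | zero => rw [map_zero, map_zero]
  | tmul m x => exact h m x
  | add s t hs ht => rw [map_add, map_add, hs, ht]

/-- The additive map `M ⊗_R X → P` induced by a balanced biadditive map. -/
def lift {P : Type*} [AddCommGroup P] (F : M →+ X →+ P)
    (hF : ∀ m (r : R) x, F (op r • m) x = F m (r • x)) : BalTensor R M X →+ P :=
  ((balRel R M X).liftQ
    (TensorProduct.liftAddHom F fun r m x => by simp).toIntLinearMap (by
      refine Submodule.span_le.2 ?_
      rintro _ ⟨m, r, x, rfl⟩
      simp [hF])).toAddMonoidHom

@[simp] theorem lift_tmul {P : Type*} [AddCommGroup P] (F : M →+ X →+ P)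
    (hF : ∀ m (r : R) x, F (op r • m) x = F m (r • x)) (m : M) (x : X) :
    lift F hF (tmul R m x) = F m x := rfl

/-- `a ⊗ b : M ⊗_R X → M' ⊗_R X'` for additive maps `a`, `b` that respect the `R`-actions. -/
def map {M' X' : Type*} [AddCommGroup M'] [Module Rᵐᵒᵖ M'] [AddCommGroup X'] [Module R X']
    (a : M →ₗ[Rᵐᵒᵖ] M') (b : X →ₗ[R] X') : BalTensor R M X →+ BalTensor R M' X' :=
  lift (AddMonoidHom.mk' (fun m => AddMonoidHom.mk' (fun x => tmul R (a m) (b x))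
      fun x y => by rw [map_add, tmul_add])
      fun m n => by ext x; simp [add_tmul])
    fun m r x => by simp [smul_tmul]

@[simp] theorem map_tmul {M' X' : Type*} [AddCommGroup M'] [Module Rᵐᵒᵖ M'] [AddCommGroup X']
    [Module R X'] (a : M →ₗ[Rᵐᵒᵖ] M') (b : X →ₗ[R] X') (m : M) (x : X) :
    map a b (tmul R m x) = tmul R (a m) (b x) := rfl

/-- If `M` is an `S`-`R`-bimodule then `M ⊗_R X` is a left `S`-module, `s (m ⊗ x) = (s m) ⊗ x`. -/
instance {S : Type*} [Ring S] [Module S M] [SMulCommClass S Rᵐᵒᵖ M] :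
    Module S (BalTensor R M X) :=
  Module.compHom (BalTensor R M X)
    ({ toFun := fun s => map (Module.toModuleEnd Rᵐᵒᵖ M s) LinearMap.id
       map_one' := addHom_ext fun m x => congrArg (tmul R · x) (one_smul S m)
       map_mul' := fun a b => addHom_ext fun m x => congrArg (tmul R · x) (mul_smul a b m)
       map_zero' := addHom_ext fun m x =>
        (congrArg (tmul R · x) (zero_smul S m)).trans (zero_tmul R x)
       map_add' := fun a b => addHom_ext fun m x =>
        (congrArg (tmul R · x) (add_smul a b m)).trans (add_tmul R _ _ _) } :
      S →+* AddMonoid.End (BalTensor R M X))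

theorem smul_tmul_left {S : Type*} [Ring S] [Module S M] [SMulCommClass S Rᵐᵒᵖ M]
    (s : S) (m : M) (x : X) : s • tmul R m x = tmul R (s • m) x := rfl

end BalTensor

end BalTensor

/-! ## `Tor₁` and `Ext¹` -/

/-- The functor `M ⊗_R -` from left `R`-modules to abelian groups. -/
def balTensorFunctor (R M : Type u) [Ring R] [AddCommGroup M] [Module Rᵐᵒᵖ M] :
    ModuleCat.{u} R ⥤ AddCommGrpCat.{u} where
  obj X := AddCommGrpCat.of (BalTensor R M X)
  map h := AddCommGrpCat.ofHom (BalTensor.map LinearMap.id h.hom)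
  map_id X := by
    ext1
    exact BalTensor.addHom_ext fun m x => rfl
  map_comp f g := by
    ext1
    exact BalTensor.addHom_ext fun m x => rfl

instance (R M : Type u) [Ring R] [AddCommGroup M] [Module Rᵐᵒᵖ M] :
    (balTensorFunctor R M).Additive where
  map_add {X Y f g} := by
    ext1
    exact BalTensor.addHom_ext fun m x => BalTensor.tmul_add R m _ _

/-- `Tor₁^R(M, X)`, the first left derived functor of `M ⊗_R -` at `X`. -/
noncomputable def torOne (R M : Type u) [Ring R] [AddCommGroup M] [Module Rᵐᵒᵖ M]
    (X : ModuleCat.{u} R) : AddCommGrpCat.{u} :=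
  ((balTensorFunctor R M).leftDerived 1).obj X

/-- `Tor₁^R(M, 𝒰) = 0`. -/
def TorOneVanishes (R M : Type u) [Ring R] [AddCommGroup M] [Module Rᵐᵒᵖ M]
    (U : ObjectProperty (ModuleCat.{u} R)) : Prop :=
  ∀ X, U X → Subsingleton (torOne R M X)

/-- `Ext¹_R(N, 𝒱) = 0`. -/
def ExtOneVanishes (R N : Type u) [Ring R] [AddCommGroup N] [Module R N]
    (V : ObjectProperty (ModuleCat.{u} R)) : Prop :=
  ∀ X, V X → Subsingleton (Abelian.Ext.{u} (ModuleCat.of R N) X 1)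

/-! ## Scalar extension along `S → S / I`, and the adjoint of `g : N ⊗_S Y → X` -/

section Base

variable {S : Type u} [Ring S] (I : Ideal S) [I.IsTwoSided]

/-- `S / I` as a right `S`-module. -/
instance quotientRightModule : Module Sᵐᵒᵖ (S ⧸ I) :=
  Module.compHom (S ⧸ I) (Ideal.Quotient.mk I).op

instance quotientSMulCommClass : SMulCommClass (S ⧸ I) Sᵐᵒᵖ (S ⧸ I) where
  smul_comm a b c := (mul_assoc a c (Ideal.Quotient.mk I b.unop)).symm

/-- The left `S / I`-module `S / I ⊗_S W`. -/
def quotientTensor (W : Type u) [AddCommGroup W] [Module S W] : ModuleCat.{u} (S ⧸ I) :=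
  ModuleCat.of (S ⧸ I) (BalTensor S (S ⧸ I) W)

end Base

section Adjoint

variable {R S N X Y : Type*} [Ring R] [Ring S] [AddCommGroup N] [Module R N] [Module Sᵐᵒᵖ N]
  [SMulCommClass R Sᵐᵒᵖ N] [AddCommGroup X] [Module R X] [AddCommGroup Y] [Module S Y]

/-- The adjoint `g̃ : Y → Hom_R(N, X)`, `g̃ y n = g (n ⊗ y)`, of `g : N ⊗_S Y → X`, for an
`R`-`S`-bimodule `N`. (It is `S`-linear for the action `(s h) n = h (n s)` on `Hom_R(N, X)`;
surjectivity does not refer to that action.) -/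
def adjointMap (g : BalTensor S N Y →ₗ[R] X) : Y →+ (N →ₗ[R] X) where
  toFun y :=
    { toFun := fun n => g (BalTensor.tmul S n y)
      map_add' := fun m n => by rw [BalTensor.add_tmul, map_add]
      map_smul' := fun r n => by
        rw [← BalTensor.smul_tmul_left, map_smul, RingHom.id_apply] }
  map_zero' := by
    ext n
    simp
  map_add' y z := by
    ext n
    simp [BalTensor.tmul_add]

/-- `Ker g̃`, an `S`-submodule of `Y`. -/
def adjointKer (g : BalTensor S N Y →ₗ[R] X) : Submodule S Y where
  carrier := {y | adjointMap g y = 0}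
  add_mem' := fun {y z} hy hz => by
    change adjointMap g (y + z) = 0
    change adjointMap g y = 0 at hy
    change adjointMap g z = 0 at hz
    rw [map_add, hy, hz, add_zero]
  zero_mem' := map_zero _
  smul_mem' s y hy := by
    change adjointMap g y = 0 at hy
    change adjointMap g (s • y) = 0
    ext n
    have h := LinearMap.congr_fun hy (op s • n)
    change g (BalTensor.tmul S (op s • n) y) = 0 at h
    rw [BalTensor.smul_tmul] at h
    exact h

end Adjoint

/-! ## Morita contexts, Morita rings and their modules -/

/-- Bimodule maps `φ : M ⊗_A N → B` and `ψ : N ⊗_B M → A` for bimodules `_B M_A`, `_A N_B`, with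
`m' ψ(n ⊗ m) = φ(m' ⊗ n) m` and `n' φ(m ⊗ n) = ψ(n' ⊗ m) n`. Left linearity of `φ` and `ψ` is part
of their type; right linearity is stated on the generators `m ⊗ n`, `n ⊗ m`. -/
structure MoritaContext (A B M N : Type u) [Ring A] [Ring B] [AddCommGroup M] [AddCommGroup N]
    [Module B M] [Module Aᵐᵒᵖ M] [SMulCommClass B Aᵐᵒᵖ M]
    [Module A N] [Module Bᵐᵒᵖ N] [SMulCommClass A Bᵐᵒᵖ N] where
  φ : BalTensor A M N →ₗ[B] B
  ψ : BalTensor B N M →ₗ[A] A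
  φ_right : ∀ (m : M) (n : N) (b : B),
    φ (BalTensor.tmul A m (op b • n)) = φ (BalTensor.tmul A m n) * b
  ψ_right : ∀ (n : N) (m : M) (a : A),
    ψ (BalTensor.tmul B n (op a • m)) = ψ (BalTensor.tmul B n m) * a
  assoc_M : ∀ (m' : M) (n : N) (m : M),
    op (ψ (BalTensor.tmul B n m)) • m' = φ (BalTensor.tmul A m' n) • m
  assoc_N : ∀ (n' : N) (m : M) (n : N),
    op (φ (BalTensor.tmul A m n)) • n' = ψ (BalTensor.tmul B n' m) • n

namespace MoritaContext

variable {A B M N : Type u} [Ring A] [Ring B] [AddCommGroup M] [AddCommGroup N]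
  [Module B M] [Module Aᵐᵒᵖ M] [SMulCommClass B Aᵐᵒᵖ M]
  [Module A N] [Module Bᵐᵒᵖ N] [SMulCommClass A Bᵐᵒᵖ N]
  (c : MoritaContext A B M N)

/-- The ideal `Im φ` of `B`. -/
def imφ : Ideal B := LinearMap.range c.φ

/-- The ideal `Im ψ` of `A`. -/
def imψ : Ideal A := LinearMap.range c.ψ

instance : c.imφ.IsTwoSided where
  mul_mem_of_left {a} b ha := by
    obtain ⟨t, rfl⟩ := ha
    induction t using BalTensor.induction_on with
    | zero => rw [map_zero, zero_mul]; exact zero_mem _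
    | tmul m n => rw [← c.φ_right]; exact ⟨_, rfl⟩
    | add s t hs ht => rw [map_add, add_mul]; exact add_mem hs ht

instance : c.imψ.IsTwoSided where
  mul_mem_of_left {a} b ha := by
    obtain ⟨t, rfl⟩ := ha
    induction t using BalTensor.induction_on with
    | zero => rw [map_zero, zero_mul]; exact zero_mem _
    | tmul m n => rw [← c.ψ_right]; exact ⟨_, rfl⟩
    | add s t hs ht => rw [map_add, add_mul]; exact add_mem hs ht

/-- The underlying set of the Morita ring `Λ`: matrices with rows `(a, n)` and `(m, b)`. -/
@[ext] structure Lam (_c : MoritaContext A B M N) : Type u where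
  a : A
  n : N
  m : M
  b : B

namespace Lam

variable {c}

instance : Zero c.Lam := ⟨⟨0, 0, 0, 0⟩⟩
instance : One c.Lam := ⟨⟨1, 0, 0, 1⟩⟩
instance : Add c.Lam := ⟨fun u v => ⟨u.a + v.a, u.n + v.n, u.m + v.m, u.b + v.b⟩⟩
instance : Neg c.Lam := ⟨fun u => ⟨-u.a, -u.n, -u.m, -u.b⟩⟩
instance : Mul c.Lam := ⟨fun u v =>
  ⟨u.a * v.a + c.ψ (BalTensor.tmul B u.n v.m),
   u.a • v.n + op v.b • u.n,
   op v.a • u.m + u.b • v.m,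
   c.φ (BalTensor.tmul A u.m v.n) + u.b * v.b⟩⟩

@[simp] theorem zero_a : (0 : c.Lam).a = 0 := rfl
@[simp] theorem zero_n : (0 : c.Lam).n = 0 := rfl
@[simp] theorem zero_m : (0 : c.Lam).m = 0 := rfl
@[simp] theorem zero_b : (0 : c.Lam).b = 0 := rfl
@[simp] theorem one_a : (1 : c.Lam).a = 1 := rfl
@[simp] theorem one_n : (1 : c.Lam).n = 0 := rfl
@[simp] theorem one_m : (1 : c.Lam).m = 0 := rfl
@[simp] theorem one_b : (1 : c.Lam).b = 1 := rfl
@[simp] theorem add_a (u v : c.Lam) : (u + v).a = u.a + v.a := rfl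
@[simp] theorem add_n (u v : c.Lam) : (u + v).n = u.n + v.n := rfl
@[simp] theorem add_m (u v : c.Lam) : (u + v).m = u.m + v.m := rfl
@[simp] theorem add_b (u v : c.Lam) : (u + v).b = u.b + v.b := rfl
@[simp] theorem neg_a (u : c.Lam) : (-u).a = -u.a := rfl
@[simp] theorem neg_n (u : c.Lam) : (-u).n = -u.n := rfl
@[simp] theorem neg_m (u : c.Lam) : (-u).m = -u.m := rfl
@[simp] theorem neg_b (u : c.Lam) : (-u).b = -u.b := rfl
@[simp] theorem mul_a (u v : c.Lam) :
    (u * v).a = u.a * v.a + c.ψ (BalTensor.tmul B u.n v.m) := rfl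
@[simp] theorem mul_n (u v : c.Lam) : (u * v).n = u.a • v.n + op v.b • u.n := rfl
@[simp] theorem mul_m (u v : c.Lam) : (u * v).m = op v.a • u.m + u.b • v.m := rfl
@[simp] theorem mul_b (u v : c.Lam) :
    (u * v).b = c.φ (BalTensor.tmul A u.m v.n) + u.b * v.b := rfl

instance : AddCommGroup c.Lam where
  add_assoc u v w := by ext <;> simp [add_assoc]
  zero_add u := by ext <;> simp
  add_zero u := by ext <;> simp
  add_comm u v := by ext <;> simp [add_comm]
  neg_add_cancel u := by ext <;> simp
  nsmul := nsmulRec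
  zsmul := zsmulRec

/-- The Morita ring `Λ`, with componentwise addition and the matrix multiplication in which
products of off-diagonal entries are formed by `φ` and `ψ`. -/
instance : Ring c.Lam where
  __ := (inferInstance : AddCommGroup c.Lam)
  zero_mul u := by ext <;> simp
  mul_zero u := by ext <;> simp
  one_mul u := by ext <;> simp
  mul_one u := by ext <;> simp
  left_distrib u v w := by
    ext <;> simp [mul_add, add_smul, smul_add, BalTensor.tmul_add] <;> abel
  right_distrib u v w := by
    ext <;> simp [add_mul, add_smul, smul_add, BalTensor.add_tmul] <;> abel
  mul_assoc u v w := by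
    ext
    · simp only [mul_a, mul_n, mul_m, add_mul, mul_add, BalTensor.add_tmul, BalTensor.tmul_add,
        map_add, BalTensor.smul_tmul, ← BalTensor.smul_tmul_left, map_smul, smul_eq_mul,
        c.ψ_right, mul_assoc]
      abel
    · simp only [mul_a, mul_n, mul_b, add_smul, smul_add, mul_smul, MulOpposite.op_add,
        MulOpposite.op_mul,
        c.assoc_N, smul_comm u.a (op w.b) v.n]
      abel
    · simp only [mul_a, mul_m, mul_b, add_smul, smul_add, mul_smul, MulOpposite.op_add,
        MulOpposite.op_mul,
        c.assoc_M, smul_comm u.b (op w.a) v.m]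
      abel
    · simp only [mul_b, mul_n, mul_m, add_mul, mul_add, BalTensor.add_tmul, BalTensor.tmul_add,
        map_add, BalTensor.smul_tmul, ← BalTensor.smul_tmul_left, map_smul, smul_eq_mul,
        c.φ_right, mul_assoc]
      abel

end Lam

/-- A quadruple `(X, Y, f, g)`: a left `A`-module `X`, a left `B`-module `Y`, a `B`-linear map
`f : M ⊗_A X → Y` and an `A`-linear map `g : N ⊗_B Y → X` with
`g(n ⊗ f(m ⊗ x)) = ψ(n ⊗ m) x` and `f(m ⊗ g(n ⊗ y)) = φ(m ⊗ n) y`. -/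
structure Quad where
  X : ModuleCat.{u} A
  Y : ModuleCat.{u} B
  f : BalTensor A M X →ₗ[B] Y
  g : BalTensor B N Y →ₗ[A] X
  g_f : ∀ (n : N) (m : M) (x : X),
    g (BalTensor.tmul B n (f (BalTensor.tmul A m x))) = c.ψ (BalTensor.tmul B n m) • x
  f_g : ∀ (m : M) (n : N) (y : Y),
    f (BalTensor.tmul A m (g (BalTensor.tmul B n y))) = c.φ (BalTensor.tmul A m n) • y

namespace Quad

variable {c}

/-- The underlying set of the `Λ`-module of a quadruple: column vectors with entries `x`, `y`. -/
@[ext] structure Col (Q : c.Quad) : Type u where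
  x : Q.X
  y : Q.Y

namespace Col

variable {Q : c.Quad}

instance : Zero Q.Col := ⟨⟨0, 0⟩⟩
instance : Add Q.Col := ⟨fun u v => ⟨u.x + v.x, u.y + v.y⟩⟩
instance : Neg Q.Col := ⟨fun u => ⟨-u.x, -u.y⟩⟩
instance : SMul c.Lam Q.Col := ⟨fun l u =>
  ⟨l.a • u.x + Q.g (BalTensor.tmul B l.n u.y), Q.f (BalTensor.tmul A l.m u.x) + l.b • u.y⟩⟩

@[simp] theorem zero_x : (0 : Q.Col).x = 0 := rfl
@[simp] theorem zero_y : (0 : Q.Col).y = 0 := rfl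
@[simp] theorem add_x (u v : Q.Col) : (u + v).x = u.x + v.x := rfl
@[simp] theorem add_y (u v : Q.Col) : (u + v).y = u.y + v.y := rfl
@[simp] theorem neg_x (u : Q.Col) : (-u).x = -u.x := rfl
@[simp] theorem neg_y (u : Q.Col) : (-u).y = -u.y := rfl
@[simp] theorem smul_x (l : c.Lam) (u : Q.Col) :
    (l • u).x = l.a • u.x + Q.g (BalTensor.tmul B l.n u.y) := rfl
@[simp] theorem smul_y (l : c.Lam) (u : Q.Col) :
    (l • u).y = Q.f (BalTensor.tmul A l.m u.x) + l.b • u.y := rfl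

instance : AddCommGroup Q.Col where
  add_assoc u v w := by ext <;> simp [add_assoc]
  zero_add u := by ext <;> simp
  add_zero u := by ext <;> simp
  add_comm u v := by ext <;> simp [add_comm]
  neg_add_cancel u := by ext <;> simp
  nsmul := nsmulRec
  zsmul := zsmulRec

instance : Module c.Lam Q.Col where
  one_smul u := by ext <;> simp
  smul_zero l := by ext <;> simp
  zero_smul u := by ext <;> simp
  smul_add l u v := by
    ext <;> simp [BalTensor.tmul_add] <;> abel
  add_smul k l u := by
    ext <;> simp [BalTensor.add_tmul, add_smul] <;> abel
  mul_smul k l u := by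
    ext
    · simp only [smul_x, smul_y, Lam.mul_a, Lam.mul_n, add_smul, mul_smul, smul_add,
        BalTensor.add_tmul, BalTensor.tmul_add, map_add, BalTensor.smul_tmul,
        ← BalTensor.smul_tmul_left, map_smul, Q.g_f]
      abel
    · simp only [smul_x, smul_y, Lam.mul_b, Lam.mul_m, add_smul, mul_smul, smul_add,
        BalTensor.add_tmul, BalTensor.tmul_add, map_add, BalTensor.smul_tmul,
        ← BalTensor.smul_tmul_left, map_smul, Q.f_g]
      abel

end Col

/-- The left `Λ`-module given by a quadruple, with the action of matrices on columns
`(x, y) ↦ (a x + g(n ⊗ y), f(m ⊗ x) + b y)`. -/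
def toLamModule (Q : c.Quad) : ModuleCat.{u} c.Lam := ModuleCat.of c.Lam Q.Col

end Quad

/-! ### The glued classes

A left `Λ`-module is identified with a quadruple up to isomorphism, and a class of modules is
closed under isomorphism. -/

/-- Modules `(X, Y, f, g)` with `B/Im φ ⊗_B Coker f` in `𝒰'`, `X` in `𝒰''` and `f` injective. -/
def classM (U' : ObjectProperty (ModuleCat.{u} (B ⧸ c.imφ)))
    (U'' : ObjectProperty (ModuleCat.{u} A)) : ObjectProperty (ModuleCat.{u} c.Lam) :=
  fun Z => ∃ Q : c.Quad, Nonempty (Z ≅ Q.toLamModule) ∧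
    U' (quotientTensor c.imφ (Q.Y ⧸ LinearMap.range Q.f)) ∧ U'' Q.X ∧ Function.Injective Q.f

/-- Modules `(X, Y, f, g)` with `B/Im φ ⊗_B Ker g̃` in `𝒱'`, `X` in `𝒱''` and `g̃` surjective. -/
def classN (V' : ObjectProperty (ModuleCat.{u} (B ⧸ c.imφ)))
    (V'' : ObjectProperty (ModuleCat.{u} A)) : ObjectProperty (ModuleCat.{u} c.Lam) :=
  fun Z => ∃ Q : c.Quad, Nonempty (Z ≅ Q.toLamModule) ∧
    V' (quotientTensor c.imφ (adjointKer Q.g)) ∧ V'' Q.X ∧ Function.Surjective (adjointMap Q.g)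

/-- Modules `(X, Y, f, g)` with `A/Im ψ ⊗_A Coker g` in `𝒞'`, `Y` in `𝒞''` and `g` injective. -/
def classMsymm (C' : ObjectProperty (ModuleCat.{u} (A ⧸ c.imψ)))
    (C'' : ObjectProperty (ModuleCat.{u} B)) : ObjectProperty (ModuleCat.{u} c.Lam) :=
  fun Z => ∃ Q : c.Quad, Nonempty (Z ≅ Q.toLamModule) ∧
    C' (quotientTensor c.imψ (Q.X ⧸ LinearMap.range Q.g)) ∧ C'' Q.Y ∧ Function.Injective Q.g

/-- Modules `(X, Y, f, g)` with `A/Im ψ ⊗_A Ker f̃` in `𝒟'`, `Y` in `𝒟''` and `f̃` surjective. -/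
def classNsymm (D' : ObjectProperty (ModuleCat.{u} (A ⧸ c.imψ)))
    (D'' : ObjectProperty (ModuleCat.{u} B)) : ObjectProperty (ModuleCat.{u} c.Lam) :=
  fun Z => ∃ Q : c.Quad, Nonempty (Z ≅ Q.toLamModule) ∧
    D' (quotientTensor c.imψ (adjointKer Q.f)) ∧ D'' Q.Y ∧ Function.Surjective (adjointMap Q.f)

end MoritaContext

/-! The module category of `Λ` is glued from `A`-modules and `B/Im φ`-modules by a recollement. The
functor `e`, sending `(X, Y, f, g)` to `X`, has left adjoint `T X = (X, M ⊗_A X)` and right adjoint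
`H X = (X, Hom_A(N, X))`. Its kernel is the image of `Z U = (0, U, 0, 0)`, because `φ(m ⊗ n) y = f(m
⊗ g(n ⊗ y))` vanishes when `X = 0`. The left and right adjoints of `Z` are `F`, namely `B/Im φ ⊗_B
Coker f`, and `G`, namely `B/Im φ ⊗_B Ker g̃`. The counit `T e Q ⟶ Q` has components `1` and `f`,
and the unit `W ⟶ H e W` has components `1` and `g̃`. So the two classes are described by `F Q`, `e
Q` and a monic counit, and by `G W`, `e W` and an epic unit.

Orthogonality. A monic counit gives `0 → T e Q → Q → Z F Q → 0`, and an epic unit gives `0 → Z G W →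
W → H e W → 0`. Filtering `Ext¹(Q, W)` by these sequences leaves only `Ext¹(e Q, e W)` and `Ext¹(F
Q, G W)` to control (`orth_of_mono_of_epi`).

Maximality. Testing `W` against `Z U` and `T X` recovers the conditions on `G W` and `e W`; testing
`Q` against `Z V` and `H X` recovers those on `F Q` and `e Q`. The Tor and Ext hypotheses keep `T`
and `H` exact on the sequences involved. Injectivity of `g̃`'s counterpart data is not needed; what
remains is that the unit is epic and the counit monic. Both follow from one fact: projective objects
have monic counit (`epi_unit_of_orth`, `mono_counit_of_orth`). This is where injectivity of `φ`
enters (`injective_f_of_projective`).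

Completeness comes from three successive pushouts, correcting `e W`, then the unit, then `G W`, each
with cokernel in the left class, followed by Salce's lemma. Heredity holds because `F` and `G` are
exact on the relevant sequences. Part II is Part I for the Morita context with `A` and `B`
exchanged. -/

open Limits Cotorsion

universe w₁ v₁ u₁ w₂ v₂ u₂ w₃ v₃ u₃ u₄ v₄

noncomputable section

/-! ### Pushouts of short exact sequences. -/

namespace CategoryTheory.ShortComplex.ShortExact

/-- The pushout of a short exact sequence along a morphism out of its first term. -/
theorem of_isPushout {C : Type u} [Category.{v} C] [Abelian C] {S : ShortComplex C}
    (hS : S.ShortExact) {W E : C} {k : S.X₁ ⟶ W} {r : S.X₂ ⟶ E} {i : W ⟶ E}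
    (sq : IsPushout S.f k r i) :
    ∃ (p : E ⟶ S.X₃) (h : i ≫ p = 0), (ShortComplex.mk i p h).ShortExact ∧ r ≫ p = S.g := by
  have := hS.mono_f
  have := hS.epi_g
  have hw : S.f ≫ S.g = k ≫ (0 : W ⟶ S.X₃) := by rw [S.zero, comp_zero]
  refine ⟨sq.desc S.g 0 hw, sq.inr_desc _ _ hw, ?_, sq.inl_desc _ _ hw⟩
  have : Epi (sq.desc S.g 0 hw) := epi_of_epi_fac (sq.inl_desc S.g 0 hw)
  have hi : Mono i := (MorphismProperty.monomorphisms C).of_isPushout sq.flip ‹_›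
  -- A map out of `E` that kills `W` is determined on `S.X₂`, where it kills `S.X₁` and so factors
  -- through `S.X₃`.
  refine .mk' (exact_of_g_is_cokernel _ (CokernelCofork.IsColimit.ofπ' _ _ fun {A} t ht => ?_))
    hi this
  have h₁ : S.f ≫ r ≫ t = 0 := by
    rw [← Category.assoc, sq.w, Category.assoc]
    exact (congrArg (k ≫ ·) ht).trans comp_zero
  refine ⟨hS.exact.desc _ h₁, ?_⟩
  dsimp only
  apply sq.hom_ext
  · rw [← Category.assoc, sq.inl_desc, hS.exact.g_desc]
  · rw [← Category.assoc, sq.inr_desc, zero_comp]; exact ht.symm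

theorem exists_pushout {C : Type u} [Category.{v} C] [Abelian C] {S : ShortComplex C}
    (hS : S.ShortExact) {W : C} (k : S.X₁ ⟶ W) :
    ∃ (E : C) (i : W ⟶ E) (r : S.X₂ ⟶ E) (p : E ⟶ S.X₃) (h : i ≫ p = 0),
      (ShortComplex.mk i p h).ShortExact ∧ IsPushout S.f k r i ∧ r ≫ p = S.g := by
  have sq := IsPushout.of_hasPushout S.f k
  obtain ⟨p, h, hE, hp⟩ := hS.of_isPushout sq
  exact ⟨_, _, _, p, h, hE, sq, hp⟩

/-- The cokernel of a composition of monomorphisms is an extension of their cokernels. -/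
theorem exists_comp {C : Type u} [Category.{v} C] [Abelian C] {X₀ X₁ X₂ C₁ C₂ : C}
    {i : X₀ ⟶ X₁} {p : X₁ ⟶ C₁} {hi : i ≫ p = 0} (h₁ : (ShortComplex.mk i p hi).ShortExact)
    {j : X₁ ⟶ X₂} {q : X₂ ⟶ C₂} {hj : j ≫ q = 0} (h₂ : (ShortComplex.mk j q hj).ShortExact) :
    ∃ (E : C) (r : X₂ ⟶ E) (hr : (i ≫ j) ≫ r = 0) (a : C₁ ⟶ E) (b : E ⟶ C₂) (hab : a ≫ b = 0),
      (ShortComplex.mk (i ≫ j) r hr).ShortExact ∧ (ShortComplex.mk a b hab).ShortExact := by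
  obtain ⟨E, a, r, b, hab, hE, sq, -⟩ := h₂.exists_pushout p
  have hi' : Mono i := h₁.mono_f
  have hj' : Mono j := h₂.mono_f
  have hp' : Epi p := h₁.epi_g
  have hr : (i ≫ j) ≫ r = 0 := by
    have := sq.w
    dsimp only at this
    rw [Category.assoc, this, ← Category.assoc, hi, zero_comp]
  have hr' : Epi r := (MorphismProperty.epimorphisms C).of_isPushout sq hp'
  refine ⟨E, r, hr, a, b, hab, .mk' (exact_of_g_is_cokernel _ (CokernelCofork.IsColimit.ofπ' _ _
    fun {A} t ht => ?_)) (inferInstanceAs (Mono (i ≫ j))) hr', hE⟩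
  have ht' : i ≫ j ≫ t = 0 := (Category.assoc _ _ _).symm.trans ht
  have hd : j ≫ t = p ≫ h₁.exact.desc (j ≫ t) ht' := (h₁.exact.g_desc _ _).symm
  exact ⟨sq.desc t _ hd, sq.inl_desc _ _ hd⟩

/-- The short exact sequence `0 → Ker p → E → Z → 0` of an epimorphism. -/
theorem of_epi {C : Type u} [Category.{v} C] [Abelian C] {E Z : C} (p : E ⟶ Z) [Epi p] :
    (ShortComplex.mk (kernel.ι p) p (kernel.condition p)).ShortExact :=
  .mk' (exact_of_f_is_kernel _ (kernelIsKernel p)) inferInstance inferInstance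

end CategoryTheory.ShortComplex.ShortExact

/-! ### Vanishing of `Ext¹` as an extension and lifting property. -/

namespace Cotorsion

section Orth

variable {E : Type u} [Category.{v} E] [Abelian E] [HasExt.{w} E]

/-- `Ext¹(Z, X) = 0`. -/
def Orth (Z X : E) : Prop := Subsingleton (Abelian.Ext.{w} Z X 1)

namespace Orth

/-- The obstruction to extending `k` is its image under the connecting map to `Ext¹(S.X₃, W)`. -/
theorem extend {S : ShortComplex E} (hS : S.ShortExact) {W : E} (h : Orth.{w} S.X₃ W)
    (k : S.X₁ ⟶ W) : ∃ k' : S.X₂ ⟶ W, S.f ≫ k' = k := by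
  obtain ⟨x, hx⟩ := Abelian.Ext.contravariant_sequence_exact₁ hS W (Abelian.Ext.mk₀ k) rfl
    (@Subsingleton.elim _ h _ _)
  refine ⟨Abelian.Ext.homEquiv₀ x, (Abelian.Ext.mk₀_bijective _ _).1 ?_⟩
  rw [← hx, ← Abelian.Ext.mk₀_comp_mk₀, Abelian.Ext.mk₀_homEquiv₀_apply]

theorem lift {S : ShortComplex E} (hS : S.ShortExact) {W : E} (h : Orth.{w} W S.X₁)
    (k : W ⟶ S.X₃) : ∃ k' : W ⟶ S.X₂, k' ≫ S.g = k := by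
  obtain ⟨x, hx⟩ := Abelian.Ext.covariant_sequence_exact₃ W hS (Abelian.Ext.mk₀ k) rfl
    (@Subsingleton.elim _ h _ _)
  refine ⟨Abelian.Ext.homEquiv₀ x, (Abelian.Ext.mk₀_bijective _ _).1 ?_⟩
  rw [← hx, ← Abelian.Ext.mk₀_comp_mk₀, Abelian.Ext.mk₀_homEquiv₀_apply]

/-- With `0 → K → P → Z → 0` and `P` projective, every class in `Ext¹(Z, X)` is the connecting image
of some `y : K ⟶ X`. A retraction of the pushout extension along `y` extends `y` to `P`, so the
class is zero. -/
theorem of_retraction [EnoughProjectives E] {Z X : E}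
    (H : ∀ (D : E) (i : X ⟶ D) (p : D ⟶ Z) (h : i ≫ p = 0),
      (ShortComplex.mk i p h).ShortExact → ∃ r : D ⟶ X, i ≫ r = 𝟙 X) : Orth.{w} Z X := by
  refine ⟨fun a b => ?_⟩
  suffices ∀ x : Abelian.Ext.{w} Z X 1, x = 0 by rw [this a, this b]
  intro x
  have hS := ShortComplex.ShortExact.of_epi (Projective.π Z)
  obtain ⟨y, rfl⟩ := Abelian.Ext.contravariant_sequence_exact₃ hS X x
    (Abelian.Ext.eq_zero_of_projective (P := Projective.over Z) _) (add_zero 1)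
  obtain ⟨D, i, r, p, h, hD, sq, -⟩ := hS.exists_pushout (Abelian.Ext.homEquiv₀ y)
  obtain ⟨q, hq⟩ := H D i p h hD
  have : y = (Abelian.Ext.mk₀ (kernel.ι (Projective.π Z))).comp
      (Abelian.Ext.mk₀ (r ≫ q)) (zero_add 0) := by
    rw [Abelian.Ext.mk₀_comp_mk₀, ← Category.assoc]
    erw [sq.w]
    rw [Category.assoc, hq, Category.comp_id, Abelian.Ext.mk₀_homEquiv₀_apply]
  rw [this]
  exact hS.extClass_comp_assoc _

theorem of_section [EnoughProjectives E] {Z X : E}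
    (H : ∀ (D : E) (i : X ⟶ D) (p : D ⟶ Z) (h : i ≫ p = 0),
      (ShortComplex.mk i p h).ShortExact → ∃ s : Z ⟶ D, s ≫ p = 𝟙 Z) : Orth.{w} Z X := by
  refine of_retraction fun D i p h hS => ?_
  obtain ⟨s, hs⟩ := H D i p h hS
  have := hS.mono_f
  have := hS.epi_g
  -- The complementary idempotent `1 - p ≫ s` lands in the kernel of `p` and yields the retraction.
  have hr : (𝟙 D - p ≫ s) ≫ p = 0 := by
    rw [Preadditive.sub_comp, Category.assoc, hs, Category.comp_id, Category.id_comp, sub_self]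
  refine ⟨hS.exact.lift (𝟙 D - p ≫ s) hr, (cancel_mono i).1 ?_⟩
  rw [Category.assoc, hS.exact.lift_f]
  rw [Preadditive.comp_sub, ← Category.assoc, h, zero_comp, sub_zero, Category.comp_id,
    Category.id_comp]

theorem of_iso_left {Z Z' X : E} (h : Orth.{w} Z X) (e : Z ≅ Z') : Orth.{w} Z' X := by
  refine ⟨fun a b => ?_⟩
  have key (x : Abelian.Ext.{w} Z' X 1) : x = 0 := by
    have h₀ : (Abelian.Ext.mk₀ e.hom).comp x (zero_add 1) = 0 := @Subsingleton.elim _ h _ _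
    have := congrArg (fun y => (Abelian.Ext.mk₀ e.inv).comp y (zero_add 1)) h₀
    simpa using this
  rw [key a, key b]

theorem of_iso_right {Z X X' : E} (h : Orth.{w} Z X) (e : X ≅ X') : Orth.{w} Z X' := by
  refine ⟨fun a b => ?_⟩
  have key (x : Abelian.Ext.{w} Z X' 1) : x = 0 := by
    have h₀ : x.comp (Abelian.Ext.mk₀ e.inv) (add_zero 1) = 0 := @Subsingleton.elim _ h _ _
    have := congrArg (fun y => y.comp (Abelian.Ext.mk₀ e.hom) (add_zero 1)) h₀
    simpa using this
  rw [key a, key b]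

theorem of_shortExact_left {S : ShortComplex E} (hS : S.ShortExact) {W : E}
    (h₁ : Orth.{w} S.X₁ W) (h₃ : Orth.{w} S.X₃ W) : Orth.{w} S.X₂ W := by
  refine ⟨fun a b => ?_⟩
  have key (x : Abelian.Ext.{w} S.X₂ W 1) : x = 0 := by
    obtain ⟨y, rfl⟩ := Abelian.Ext.contravariant_sequence_exact₂ hS W x
      (@Subsingleton.elim _ h₁ _ _)
    rw [@Subsingleton.elim _ h₃ y 0, Abelian.Ext.comp_zero]
  rw [key a, key b]

theorem of_shortExact_right {S : ShortComplex E} (hS : S.ShortExact) {W : E}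
    (h₁ : Orth.{w} W S.X₁) (h₃ : Orth.{w} W S.X₃) : Orth.{w} W S.X₂ := by
  refine ⟨fun a b => ?_⟩
  have key (x : Abelian.Ext.{w} W S.X₂ 1) : x = 0 := by
    obtain ⟨y, rfl⟩ := Abelian.Ext.covariant_sequence_exact₂ W hS x
      (@Subsingleton.elim _ h₃ _ _)
    rw [@Subsingleton.elim _ h₁ y 0, Abelian.Ext.zero_comp]
  rw [key a, key b]

theorem of_projective (P X : E) [Projective P] : Orth.{w} P X :=
  Abelian.Ext.subsingleton_of_projective P X 0

theorem of_injective (Z I : E) [Injective I] : Orth.{w} Z I :=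
  Abelian.Ext.subsingleton_of_injective Z I 0

theorem of_isZero_left {Z : E} (hZ : IsZero Z) (X : E) : Orth.{w} Z X :=
  have : Projective Z := ⟨fun _ _ _ => ⟨0, hZ.eq_of_src _ _⟩⟩
  of_projective Z X

theorem of_isZero_right (Z : E) {X : E} (hX : IsZero X) : Orth.{w} Z X :=
  have : Injective X := ⟨fun _ _ _ => ⟨0, hX.eq_of_tgt _ _⟩⟩
  of_injective Z X

end Orth

end Orth

/-! ### Vanishing of `Ext¹` across an adjunction. -/

section Adjunction

variable {C : Type u₁} [Category.{v₁} C] [Abelian C]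
  {D : Type u₂} [Category.{v₂} D] [Abelian D]
  {L : C ⥤ D} {R : D ⥤ C} (adj : L ⊣ R)

include adj

/-- A map out of `L S.X₂` that kills `L S.X₁` is adjoint to one out of `S.X₂` that kills `S.X₁`,
hence factors through `S.X₃`. -/
theorem map_exact_left [L.PreservesZeroMorphisms] {S : ShortComplex C} (hS : S.ShortExact) :
    (S.map L).Exact ∧ Epi (L.map S.g) := by
  have := hS.epi_g
  have : L.IsLeftAdjoint := ⟨R, ⟨adj⟩⟩
  have he : Epi (S.map L).g := inferInstanceAs (Epi (L.map S.g))
  have key {A : D} (t : L.obj S.X₂ ⟶ A) (ht : L.map S.f ≫ t = 0) :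
      ∃ d : L.obj S.X₃ ⟶ A, L.map S.g ≫ d = t := by
    have h₀ : S.f ≫ adj.homEquiv _ _ t = 0 := by
      rw [← adj.homEquiv_naturality_left, ht, ← Equiv.eq_symm_apply]
      have := adj.homEquiv_naturality_left_symm (0 : S.X₁ ⟶ S.X₁) (0 : _ ⟶ R.obj A)
      rw [zero_comp, L.map_zero, zero_comp] at this
      exact this.symm
    refine ⟨(adj.homEquiv _ _).symm (hS.exact.desc _ h₀), ?_⟩
    rw [← adj.homEquiv_naturality_left_symm, hS.exact.g_desc, Equiv.symm_apply_apply]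
  exact ⟨ShortComplex.exact_of_g_is_cokernel _ (CokernelCofork.IsColimit.ofπ' _ _ fun t ht =>
    ⟨(key t ht).choose, (key t ht).choose_spec⟩), he⟩

theorem map_exact_right [R.PreservesZeroMorphisms] {S : ShortComplex D} (hS : S.ShortExact) :
    (S.map R).Exact ∧ Mono (R.map S.f) := by
  have := hS.mono_f
  have : R.IsRightAdjoint := ⟨L, ⟨adj⟩⟩
  have hm : Mono (S.map R).f := inferInstanceAs (Mono (R.map S.f))
  have key {A : C} (t : A ⟶ R.obj S.X₂) (ht : t ≫ R.map S.g = 0) :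
      ∃ d : A ⟶ R.obj S.X₁, d ≫ R.map S.f = t := by
    have h₀ : (adj.homEquiv _ _).symm t ≫ S.g = 0 := by
      rw [← adj.homEquiv_naturality_right_symm, ht, Equiv.symm_apply_eq]
      have := adj.homEquiv_naturality_right (0 : L.obj A ⟶ S.X₃) (0 : _ ⟶ S.X₃)
      rw [zero_comp, R.map_zero, comp_zero] at this
      exact this.symm
    refine ⟨adj.homEquiv _ _ (hS.exact.lift _ h₀), ?_⟩
    rw [← adj.homEquiv_naturality_right, hS.exact.lift_f, Equiv.apply_symm_apply]
  exact ⟨ShortComplex.exact_of_f_is_kernel _ (KernelFork.IsLimit.ofι' _ _ fun t ht =>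
    ⟨(key t ht).choose, (key t ht).choose_spec⟩), hm⟩

variable [HasExt.{w₁} C] [HasExt.{w₂} D]

/-- Exactness of `R` carries an extension of `L X` by `W` to one along which the unit of `X` lifts;
the adjoint of the lift is a section. -/
theorem Orth.left_adjoint_obj [EnoughProjectives D] [R.PreservesZeroMorphisms]
    [PreservesFiniteLimits R] [PreservesFiniteColimits R] {X : C} {W : D}
    (h : Orth.{w₁} X (R.obj W)) : Orth.{w₂} (L.obj X) W := by
  refine of_section fun E i p hip hS => ?_
  obtain ⟨k, hk⟩ : ∃ k : X ⟶ R.obj E, k ≫ R.map p = adj.unit.app X :=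
    Orth.lift (hS.map_of_exact R) h (adj.unit.app X)
  refine ⟨(adj.homEquiv _ _).symm k, (adj.homEquiv _ _).injective ?_⟩
  rw [adj.homEquiv_naturality_right, Equiv.apply_symm_apply, adj.homEquiv_id]
  exact hk

/-- A partial converse in which `L` need not be exact: only the sequences ending in `X` have to stay
exact, so that the counit at `W` extends over `L` of the middle term. -/
theorem Orth.of_left_adjoint_obj [EnoughProjectives C] [L.PreservesZeroMorphisms] {X : C} {W : D}
    (h : Orth.{w₂} (L.obj X) W)
    (hL : ∀ S : ShortComplex C, S.ShortExact → S.X₃ = X → Mono (L.map S.f)) :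
    Orth.{w₁} X (R.obj W) := by
  refine of_retraction fun E i p hip hS => ?_
  have hS' := map_exact_left adj hS
  obtain ⟨k, hk⟩ : ∃ k : L.obj E ⟶ W, L.map i ≫ k = adj.counit.app W :=
    Orth.extend (.mk' hS'.1 (hL _ hS rfl) hS'.2) h (adj.counit.app W)
  refine ⟨adj.homEquiv _ _ k, (adj.homEquiv _ _).symm.injective ?_⟩
  rw [adj.homEquiv_naturality_left_symm, Equiv.symm_apply_apply, adj.homEquiv_symm_id]
  exact hk

theorem Orth.right_adjoint_obj [EnoughProjectives C] [L.PreservesZeroMorphisms]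
    [PreservesFiniteLimits L] [PreservesFiniteColimits L] {X : C} {W : D}
    (h : Orth.{w₂} (L.obj X) W) : Orth.{w₁} X (R.obj W) := by
  refine of_retraction fun E i p hip hS => ?_
  obtain ⟨k, hk⟩ : ∃ k : L.obj E ⟶ W, L.map i ≫ k = adj.counit.app W :=
    Orth.extend (hS.map_of_exact L) h (adj.counit.app W)
  refine ⟨adj.homEquiv _ _ k, (adj.homEquiv _ _).symm.injective ?_⟩
  rw [adj.homEquiv_naturality_left_symm, Equiv.symm_apply_apply, adj.homEquiv_symm_id]
  exact hk

theorem Orth.of_right_adjoint_obj [EnoughProjectives D] [R.PreservesZeroMorphisms] {X : C} {W : D}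
    (h : Orth.{w₁} X (R.obj W))
    (hR : ∀ S : ShortComplex D, S.ShortExact → S.X₁ = W → Epi (R.map S.g)) :
    Orth.{w₂} (L.obj X) W := by
  refine of_section fun E i p hip hS => ?_
  have hS' := map_exact_right adj hS
  obtain ⟨k, hk⟩ : ∃ k : X ⟶ R.obj E, k ≫ R.map p = adj.unit.app X :=
    Orth.lift (.mk' hS'.1 hS'.2 (hR _ hS rfl)) h (adj.unit.app X)
  refine ⟨(adj.homEquiv _ _).symm k, (adj.homEquiv _ _).injective ?_⟩
  rw [adj.homEquiv_naturality_right, Equiv.apply_symm_apply, adj.homEquiv_id]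
  exact hk

end Adjunction

end Cotorsion

/-! ### Closure properties of cotorsion pairs and Salce's lemma. -/

namespace Cotorsion.IsCotorsionPair

variable {E : Type u} [Category.{v} E] [Abelian E] [HasExt.{w} E] {C D : ObjectProperty E}
  (h : IsCotorsionPair.{w} C D)

include h

theorem orth {X Y : E} (hX : C X) (hY : D Y) : Orth.{w} X Y := by
  rw [← h.rightPerp_eq] at hY
  exact hY X hX

theorem mem_left {X : E} (H : ∀ Y, D Y → Orth.{w} X Y) : C X := by
  rw [← h.leftPerp_eq]
  exact H

theorem mem_right {Y : E} (H : ∀ X, C X → Orth.{w} X Y) : D Y := by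
  rw [← h.rightPerp_eq]
  exact H

theorem left_of_iso {X X' : E} (e : X ≅ X') (hX : C X) : C X' :=
  h.mem_left fun _ hY => (h.orth hX hY).of_iso_left e

theorem right_of_iso {Y Y' : E} (e : Y ≅ Y') (hY : D Y) : D Y' :=
  h.mem_right fun _ hX => (h.orth hX hY).of_iso_right e

theorem left_of_projective (P : E) [Projective P] : C P :=
  h.mem_left fun _ _ => .of_projective _ _

theorem right_of_injective (I : E) [Injective I] : D I :=
  h.mem_right fun _ _ => .of_injective _ _

theorem left_of_isZero {X : E} (hX : Limits.IsZero X) : C X :=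
  h.mem_left fun _ _ => .of_isZero_left hX _

theorem right_of_isZero {X : E} (hX : Limits.IsZero X) : D X :=
  h.mem_right fun _ _ => .of_isZero_right _ hX

theorem left_of_shortExact {S : ShortComplex E} (hS : S.ShortExact) (h₁ : C S.X₁) (h₃ : C S.X₃) :
    C S.X₂ :=
  h.mem_left fun _ hY => .of_shortExact_left hS (h.orth h₁ hY) (h.orth h₃ hY)

end Cotorsion.IsCotorsionPair

namespace Cotorsion.IsCotorsionPair

/-- Salce's lemma: special preenvelopes give special precovers. -/
theorem isComplete_of_exists_right {E : Type u} [Category.{v} E] [Abelian E] [HasExt.{w} E]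
    [EnoughProjectives E] {C D : ObjectProperty E} (h : IsCotorsionPair.{w} C D)
    (H : ∀ X : E, ∃ (D₂ C₂ : E) (i : X ⟶ D₂) (p : D₂ ⟶ C₂) (h : i ≫ p = 0),
      C C₂ ∧ D D₂ ∧ (ShortComplex.mk i p h).ShortExact) : IsComplete C D := by
  refine ⟨fun X => ?_, H⟩
  have hP := ShortComplex.ShortExact.of_epi (Projective.π X)
  obtain ⟨D₂, C₂, i, p, hip, hC, hD, hS⟩ := H (Limits.kernel (Projective.π X))
  -- The pushout `Q` of the preenvelope of the syzygy is read in two ways: as an extension of `C₂`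
  -- by the projective, hence in `C`, and as an extension of `X` by `D₂`.
  obtain ⟨Q, j, r, q, hq, hQ, sq, -⟩ := hS.exists_pushout (Limits.kernel.ι (Projective.π X))
  obtain ⟨q', hq', hQ', -⟩ := hP.of_isPushout (W := D₂) sq.flip
  exact ⟨D₂, Q, r, q', hq', h.left_of_shortExact hQ (h.left_of_projective _) hC, hD, hQ'⟩

end Cotorsion.IsCotorsionPair

/-- A recollement of an abelian category `E` by abelian categories `B` and `A`: functors
`T ⊣ e ⊣ H` between `E` and `A` and `F ⊣ Z ⊣ G` between `E` and `B`, with `T` and `Z` fully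
faithful, such that the essential image of `Z` is the kernel of `e`. -/
structure Recollement (A : Type u₁) [Category.{v₁} A] (B : Type u₂) [Category.{v₂} B]
    (E : Type u₃) [Category.{v₃} E] where
  T : A ⥤ E
  e : E ⥤ A
  H : A ⥤ E
  F : E ⥤ B
  Z : B ⥤ E
  G : E ⥤ B
  adjTe : T ⊣ e
  adjeH : e ⊣ H
  adjFZ : F ⊣ Z
  adjZG : Z ⊣ G
  full_T : T.Full
  faithful_T : T.Faithful
  full_Z : Z.Full
  faithful_Z : Z.Faithful
  isZero_e_Z : ∀ U, IsZero (e.obj (Z.obj U))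
  essImage_Z : ∀ W, IsZero (e.obj W) → Z.essImage W

/-! ### Canonical sequences and orthogonality in a recollement. -/

namespace Recollement

variable {A : Type u₁} [Category.{v₁} A] [Abelian A] {B : Type u₂} [Category.{v₂} B] [Abelian B]
  {E : Type u₃} [Category.{v₃} E] [Abelian E] (R : Recollement A B E)

instance : R.T.Full := R.full_T
instance : R.T.Faithful := R.faithful_T
instance : R.Z.Full := R.full_Z
instance : R.Z.Faithful := R.faithful_Z
instance : R.T.IsLeftAdjoint := ⟨_, ⟨R.adjTe⟩⟩
instance : R.e.IsLeftAdjoint := ⟨_, ⟨R.adjeH⟩⟩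
instance : R.e.IsRightAdjoint := ⟨_, ⟨R.adjTe⟩⟩
instance : R.H.IsRightAdjoint := ⟨_, ⟨R.adjeH⟩⟩
instance : R.F.IsLeftAdjoint := ⟨_, ⟨R.adjFZ⟩⟩
instance : R.Z.IsLeftAdjoint := ⟨_, ⟨R.adjZG⟩⟩
instance : R.Z.IsRightAdjoint := ⟨_, ⟨R.adjFZ⟩⟩
instance : R.G.IsRightAdjoint := ⟨_, ⟨R.adjZG⟩⟩
instance : R.T.PreservesZeroMorphisms := R.T.preservesZeroMorphisms_of_isLeftAdjoint
instance : R.e.PreservesZeroMorphisms := R.e.preservesZeroMorphisms_of_isLeftAdjoint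
instance : R.H.PreservesZeroMorphisms := R.H.preservesZeroMorphisms_of_isRightAdjoint
instance : R.F.PreservesZeroMorphisms := R.F.preservesZeroMorphisms_of_isLeftAdjoint
instance : R.Z.PreservesZeroMorphisms := R.Z.preservesZeroMorphisms_of_isLeftAdjoint
instance : R.G.PreservesZeroMorphisms := R.G.preservesZeroMorphisms_of_isRightAdjoint
instance : PreservesColimits R.e := R.adjeH.leftAdjoint_preservesColimits
instance : PreservesLimits R.e := R.adjTe.rightAdjoint_preservesLimits
instance : PreservesColimits R.Z := R.adjZG.leftAdjoint_preservesColimits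
instance : PreservesLimits R.Z := R.adjFZ.rightAdjoint_preservesLimits

omit [Abelian A] [Abelian B] [Abelian E] in
-- In an adjoint triple the two outer functors are fully faithful together.
theorem full_faithful_H : R.H.Full ∧ R.H.Faithful := by
  let t : Adjunction.Triple R.T R.e R.H := ⟨R.adjTe, R.adjeH⟩
  let f := t.fullyFaithfulEquiv (.ofFullyFaithful _)
  exact ⟨f.full, f.faithful⟩

instance : R.H.Full := R.full_faithful_H.1
instance : R.H.Faithful := R.full_faithful_H.2

omit [Abelian A] [Abelian B] in
theorem T_obj_comp_Z_eq_zero [HasZeroMorphisms A] {X : A} {U : B} (k : R.T.obj X ⟶ R.Z.obj U) :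
    k = 0 :=
  (R.adjTe.homEquiv _ _).injective ((R.isZero_e_Z U).eq_of_tgt _ _)

omit [Abelian A] [Abelian B] in
theorem Z_obj_comp_H_eq_zero [HasZeroMorphisms A] {X : A} {U : B} (k : R.Z.obj U ⟶ R.H.obj X) :
    k = 0 :=
  (R.adjeH.homEquiv _ _).symm.injective ((R.isZero_e_Z U).eq_of_src _ _)

/-- The cokernel of `Q ⟶ Z F Q` is killed by `e`, so it comes from `B`. The projection onto it is
then the image under `Z` of a map whose adjoint is zero. -/
instance (Q : E) : Epi (R.adjFZ.unit.app Q) := by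
  apply Abelian.epi_of_cokernel_π_eq_zero
  have hS : R.Z.essImage (cokernel (R.adjFZ.unit.app Q)) := by
    refine R.essImage_Z _ (IsZero.of_epi (R.e.map (cokernel.π _)) (R.isZero_e_Z _))
  obtain ⟨C, ⟨j⟩⟩ := hS
  rw [← cancel_mono j.inv, zero_comp]
  obtain ⟨m, hm⟩ := R.Z.map_surjective (cokernel.π (R.adjFZ.unit.app Q) ≫ j.inv)
  rw [← hm]
  have : m = 0 := (R.adjFZ.homEquiv _ _).injective (by
    rw [Adjunction.homEquiv_unit, Adjunction.homEquiv_unit, hm, R.Z.map_zero, comp_zero,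
      cokernel.condition_assoc, zero_comp])
  rw [this, R.Z.map_zero]

instance (W : E) : Mono (R.adjZG.counit.app W) := by
  apply Abelian.mono_of_kernel_ι_eq_zero
  have hS : R.Z.essImage (kernel (R.adjZG.counit.app W)) := by
    refine R.essImage_Z _ (IsZero.of_mono (R.e.map (kernel.ι _)) (R.isZero_e_Z _))
  obtain ⟨C, ⟨j⟩⟩ := hS
  rw [← cancel_epi j.hom, comp_zero]
  obtain ⟨m, hm⟩ := R.Z.map_surjective (j.hom ≫ kernel.ι (R.adjZG.counit.app W))
  rw [← hm]
  have : m = 0 := (R.adjZG.homEquiv _ _).symm.injective (by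
    rw [Adjunction.homEquiv_counit, Adjunction.homEquiv_counit, hm, R.Z.map_zero, zero_comp,
      Category.assoc, kernel.condition, comp_zero])
  rw [this, R.Z.map_zero]

/-- Since `e` inverts `i`, it kills the cokernel of `i`, which is therefore in the image of `Z`. The
projection onto it factors through `Q ⟶ Z F Q`, which makes the latter a cokernel of `i`. -/
theorem shortExact_of_mono {K Q : E} {i : K ⟶ Q} [Mono i] [IsIso (R.e.map i)]
    (w : i ≫ R.adjFZ.unit.app Q = 0) :
    (ShortComplex.mk i (R.adjFZ.unit.app Q) w).ShortExact := by
  refine .mk' (ShortComplex.exact_of_g_is_cokernel _ (CokernelCofork.IsColimit.ofπ' _ _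
    fun {V} t ht => Classical.choice ?_)) ‹_› (inferInstanceAs (Epi (R.adjFZ.unit.app Q)))
  have h₀ : R.e.map (cokernel.π i) = 0 := by
    rw [← cancel_epi (R.e.map i), ← R.e.map_comp, cokernel.condition, R.e.map_zero, comp_zero]
  obtain ⟨C, ⟨j⟩⟩ := R.essImage_Z (cokernel i) (IsZero.of_epi_eq_zero _ h₀)
  have hk := (R.adjFZ.homEquiv Q C).apply_symm_apply (cokernel.π i ≫ j.inv)
  rw [Adjunction.homEquiv_unit] at hk
  refine ⟨⟨R.Z.map ((R.adjFZ.homEquiv Q C).symm (cokernel.π i ≫ j.inv)) ≫ j.hom ≫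
    cokernel.desc i t ht, ?_⟩⟩
  dsimp only
  rw [reassoc_of% hk]
  simp

theorem shortExact_of_epi {W K : E} {p : W ⟶ K} [Epi p] [IsIso (R.e.map p)]
    (w : R.adjZG.counit.app W ≫ p = 0) :
    (ShortComplex.mk (R.adjZG.counit.app W) p w).ShortExact := by
  refine .mk' (ShortComplex.exact_of_f_is_kernel _ (KernelFork.IsLimit.ofι' _ _
    fun {V} t ht => Classical.choice ?_)) (inferInstanceAs (Mono (R.adjZG.counit.app W))) ‹_›
  have h₀ : R.e.map (kernel.ι p) = 0 := by
    rw [← cancel_mono (R.e.map p), ← R.e.map_comp, kernel.condition, R.e.map_zero, zero_comp]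
  obtain ⟨C, ⟨j⟩⟩ := R.essImage_Z (kernel p) (IsZero.of_mono_eq_zero _ h₀)
  have hk := (R.adjZG.homEquiv C W).symm_apply_apply (j.hom ≫ kernel.ι p)
  rw [Adjunction.homEquiv_counit] at hk
  refine ⟨⟨kernel.lift p t ht ≫ j.inv ≫
    R.Z.map (R.adjZG.homEquiv C W (j.hom ≫ kernel.ι p)), ?_⟩⟩
  dsimp only
  rw [Category.assoc, Category.assoc, hk]
  simp

/-- Full faithfulness of `T` makes `e` invert the counit, so only its being monic has to be assumed.
-/
theorem shortExact_counit (Q : E) [Mono (R.adjTe.counit.app Q)] :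
    (ShortComplex.mk (R.adjTe.counit.app Q) (R.adjFZ.unit.app Q)
      (R.T_obj_comp_Z_eq_zero _)).ShortExact :=
  R.shortExact_of_mono _

theorem shortExact_unit (W : E) [Epi (R.adjeH.unit.app W)] :
    (ShortComplex.mk (R.adjZG.counit.app W) (R.adjeH.unit.app W)
      (R.Z_obj_comp_H_eq_zero _)).ShortExact :=
  R.shortExact_of_epi _

/-- The objects `Q` with `F Q` in `U'` and `e Q` in `U''` for which `T e Q ⟶ Q` is mono. -/
def leftClass (U' : ObjectProperty B) (U'' : ObjectProperty A) : ObjectProperty E :=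
  fun Q => U' (R.F.obj Q) ∧ U'' (R.e.obj Q) ∧ Mono (R.adjTe.counit.app Q)

/-- The objects `W` with `G W` in `V'` and `e W` in `V''` for which `W ⟶ H e W` is epi. -/
def rightClass (V' : ObjectProperty B) (V'' : ObjectProperty A) : ObjectProperty E :=
  fun W => V' (R.G.obj W) ∧ V'' (R.e.obj W) ∧ Epi (R.adjeH.unit.app W)

section Orth

variable [HasExt.{w₁} A] [HasExt.{w₂} B] [HasExt.{w₃} E] [EnoughProjectives E]

omit [HasExt.{w₁} A] in
-- The image of `Z` is the kernel of the exact functor `e`, hence closed under extensions: an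
-- extension of `Z U` by `Z V` comes from one of `U` by `V`, which splits.
theorem orth_Z {U V : B} (h : Orth.{w₂} U V) : Orth.{w₃} (R.Z.obj U) (R.Z.obj V) := by
  refine .of_retraction fun D i p hip hS => ?_
  obtain ⟨D', ⟨j⟩⟩ : R.Z.essImage D := by
    refine R.essImage_Z _ ?_
    exact (hS.map_of_exact R.e).exact.isZero_of_both_zeros
      ((R.isZero_e_Z V).eq_of_src _ _) ((R.isZero_e_Z U).eq_of_tgt _ _)
  obtain ⟨i', hi⟩ := R.Z.map_surjective (i ≫ j.inv)
  obtain ⟨p', hp⟩ := R.Z.map_surjective (j.hom ≫ p)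
  have hS' : ShortComplex.ShortExact (ShortComplex.mk i' p' (R.Z.map_injective (by
      rw [R.Z.map_comp, hi, hp, R.Z.map_zero, Category.assoc, j.inv_hom_id_assoc, hip]))) := by
    have hp' : j.inv ≫ R.Z.map p' = p := by rw [hp, j.inv_hom_id_assoc]
    have := hS.mono_f
    have := hS.epi_g
    have hm : Mono (R.Z.map i') := hi ▸ mono_comp i j.inv
    have he : Epi (R.Z.map p') := hp ▸ epi_comp j.hom p
    refine .mk' (R.Z.reflects_exact_of_faithful _ ?_) (R.Z.mono_of_mono_map hm)
      (R.Z.epi_of_epi_map he)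
    refine ShortComplex.exact_of_iso (S₁ := .mk i p hip)
      (S₂ := ShortComplex.map (.mk i' p' _) R.Z)
      (ShortComplex.isoMk (Iso.refl _) j.symm (Iso.refl _) ?_ ?_) hS.exact
    · exact (Category.id_comp _).trans hi
    · exact hp'.trans (Category.comp_id p).symm
  obtain ⟨r, hr⟩ := Orth.extend hS' h (𝟙 _)
  refine ⟨j.inv ≫ R.Z.map r, ?_⟩
  rw [← Category.assoc, ← hi, ← R.Z.map_comp]
  erw [hr]
  exact R.Z.map_id _

/-- The piece `T e Q` against `W` reduces to `Ext¹(e Q, e W)`, the piece `Z F Q` against `Z G W` to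
`Ext¹(F Q, G W)`, and `Z F Q` against `H e W` vanishes because `e Z = 0`. -/
theorem orth_of_mono_of_epi {Q W : E} [Mono (R.adjTe.counit.app Q)] [Epi (R.adjeH.unit.app W)]
    (h' : Orth.{w₂} (R.F.obj Q) (R.G.obj W)) (h'' : Orth.{w₁} (R.e.obj Q) (R.e.obj W)) :
    Orth.{w₃} Q W := by
  refine .of_shortExact_left (R.shortExact_counit Q) (Orth.left_adjoint_obj R.adjTe h'')
    (.of_shortExact_right (R.shortExact_unit W) (R.orth_Z h') ?_)
  exact Orth.right_adjoint_obj R.adjeH (.of_isZero_left (R.isZero_e_Z _) _)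

end Orth

end Recollement

/-! ### Glued cotorsion pairs: membership tests and heredity. -/

namespace Recollement

variable {A : Type u₁} [Category.{v₁} A] [Abelian A] {B : Type u₂} [Category.{v₂} B] [Abelian B]
  {E : Type u₃} [Category.{v₃} E] [Abelian E] (R : Recollement A B E)

section Adjoints

omit [Abelian A] [Abelian B] [Abelian E]

theorem adjeH_homEquiv_symm_comp_unit {Q W : E} (k : Q ⟶ W) :
    (R.adjeH.homEquiv _ _).symm (k ≫ R.adjeH.unit.app W) = R.e.map k := by
  rw [R.adjeH.homEquiv_naturality_left_symm, ← R.adjeH.homEquiv_id, Equiv.symm_apply_apply,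
    Category.comp_id]

theorem adjTe_homEquiv_counit_comp {Q W : E} (k : Q ⟶ W) :
    R.adjTe.homEquiv _ _ (R.adjTe.counit.app Q ≫ k) = R.e.map k := by
  rw [R.adjTe.homEquiv_naturality_right, ← R.adjTe.homEquiv_symm_id]
  exact (congrArg (· ≫ _) (Equiv.apply_symm_apply _ _)).trans (Category.id_comp _)

/-- A morphism `k : Q ⟶ W` corresponds to the same morphism `e Q ⟶ e W` whether it is composed
with `T e Q ⟶ Q` or with `W ⟶ H e W`. -/
theorem counit_comp_eq_iff_comp_unit_eq {Q W : E} (k : Q ⟶ W) (x : R.e.obj Q ⟶ R.e.obj W) :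
    R.adjTe.counit.app Q ≫ k = (R.adjTe.homEquiv _ _).symm x ↔
      k ≫ R.adjeH.unit.app W = R.adjeH.homEquiv _ _ x := by
  rw [Equiv.eq_symm_apply, adjTe_homEquiv_counit_comp, ← Equiv.symm_apply_eq,
    adjeH_homEquiv_symm_comp_unit]

end Adjoints

section

variable [HasExt.{w₁} A] [HasExt.{w₂} B] [HasExt.{w₃} E] [EnoughProjectives E]
  (hproj : ∀ P : E, Projective P → Mono (R.adjTe.counit.app P))

omit [HasExt.{w₁} A] [HasExt.{w₂} B]

omit [Abelian A] [HasExt.{w₃} E] [EnoughProjectives E] in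
theorem projective_F_obj (P : E) [Projective P] : Projective (R.F.obj P) :=
  R.adjFZ.map_projective P ‹_›

omit [Abelian A] [HasExt.{w₃} E] [EnoughProjectives E] in
theorem injective_G_obj (J : E) [Injective J] : Injective (R.G.obj J) :=
  R.adjZG.map_injective J ‹_›

include hproj

/-- Take an epimorphism from a projective `P` onto `H e W`. Its transpose `T e P ⟶ W` extends over
`P`, since `0 → T e P → P → Z F P → 0` is exact with `F P` projective. Following the extension by
the unit of `W` gives back the epimorphism. -/
theorem epi_unit_of_orth {W : E} (h : ∀ U : B, Projective U → Orth.{w₃} (R.Z.obj U) W) :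
    Epi (R.adjeH.unit.app W) := by
  let P := Projective.over (R.H.obj (R.e.obj W))
  let p : P ⟶ R.H.obj (R.e.obj W) := Projective.π _
  have := hproj P inferInstance
  obtain ⟨k, hk⟩ : ∃ k : P ⟶ W, R.adjTe.counit.app P ≫ k =
      (R.adjTe.homEquiv _ _).symm ((R.adjeH.homEquiv _ _).symm p) :=
    Orth.extend (R.shortExact_counit P) (h _ (R.projective_F_obj P)) _
  have hk' := (R.counit_comp_eq_iff_comp_unit_eq k _).1 hk
  rw [Equiv.apply_symm_apply] at hk'
  have : Epi p := inferInstanceAs (Epi (Projective.π _))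
  exact epi_of_epi_fac hk'

theorem epi_unit_of_injective (J : E) [Injective J] : Epi (R.adjeH.unit.app J) :=
  R.epi_unit_of_orth hproj fun _ _ => .of_injective _ _

/-- Dual argument: embed `T e Q` in an injective `J`, whose unit is epic by the preceding result,
and lift the transpose `Q ⟶ H e J` along `J ⟶ H e J`. Thus the hypothesis on projectives serves both
sides. -/
theorem mono_counit_of_orth [EnoughInjectives E] {Q : E}
    (h : ∀ V : B, Injective V → Orth.{w₃} Q (R.Z.obj V)) : Mono (R.adjTe.counit.app Q) := by
  let J := Injective.under (R.T.obj (R.e.obj Q))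
  let j : R.T.obj (R.e.obj Q) ⟶ J := Injective.ι _
  have := R.epi_unit_of_injective hproj J
  obtain ⟨k, hk⟩ : ∃ k : Q ⟶ J, k ≫ R.adjeH.unit.app J =
      R.adjeH.homEquiv _ _ (R.adjTe.homEquiv _ _ j) :=
    Orth.lift (R.shortExact_unit J) (h _ (R.injective_G_obj J)) _
  have hk' := (R.counit_comp_eq_iff_comp_unit_eq k _).2 hk
  rw [Equiv.symm_apply_apply] at hk'
  have : Mono j := inferInstanceAs (Mono (Injective.ι _))
  exact mono_of_mono_fac hk'

end

section Classes

variable {U' V' : ObjectProperty B} {U'' V'' : ObjectProperty A}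

section

variable [HasExt.{w₁} A] [HasExt.{w₂} B]
  (h' : IsCotorsionPair.{w₂} U' V') (h'' : IsCotorsionPair.{w₁} U'' V'')

include h' h''

theorem leftClass_Z_obj {U : B} (hU : U' U) : R.leftClass U' U'' (R.Z.obj U) :=
  ⟨h'.left_of_iso (asIso (R.adjFZ.counit.app U)).symm hU, h''.left_of_isZero (R.isZero_e_Z U),
    ⟨fun _ _ _ => (R.T.map_isZero (R.isZero_e_Z U)).eq_of_tgt _ _⟩⟩

theorem rightClass_Z_obj {V : B} (hV : V' V) : R.rightClass V' V'' (R.Z.obj V) :=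
  ⟨h'.right_of_iso (asIso (R.adjZG.unit.app V)) hV, h''.right_of_isZero (R.isZero_e_Z V),
    ⟨fun _ _ _ => (R.H.map_isZero (R.isZero_e_Z V)).eq_of_src _ _⟩⟩

end

section

variable [HasExt.{w₁} A] [HasExt.{w₂} B] [HasExt.{w₃} E] [EnoughProjectives A]
  [EnoughProjectives B] [EnoughProjectives E] [EnoughInjectives E]
  (hproj : ∀ P : E, Projective P → Mono (R.adjTe.counit.app P))
  (h' : IsCotorsionPair.{w₂} U' V') (h'' : IsCotorsionPair.{w₁} U'' V'')

omit [EnoughProjectives A] [EnoughProjectives B] [EnoughInjectives E] in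
include h' h'' in
theorem orth_of_mem_classes {Q W : E} (hQ : R.leftClass U' U'' Q) (hW : R.rightClass V' V'' W) :
    Orth.{w₃} Q W :=
  have := hQ.2.2
  have := hW.2.2
  R.orth_of_mono_of_epi (h'.orth hQ.1 hW.1) (h''.orth hQ.2.1 hW.2.1)

section

variable (hT : ∀ S : ShortComplex A, S.ShortExact → U'' S.X₃ → Mono (R.T.map S.f))

include hT h' h''

omit [EnoughProjectives A] [EnoughProjectives B] [HasExt.{w₃} E] [EnoughProjectives E]
  [EnoughInjectives E] hT in
-- `F T` vanishes because there are no nonzero maps from the image of `T` to that of `Z`.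
theorem leftClass_T_obj {X : A} (hX : U'' X) : R.leftClass U' U'' (R.T.obj X) :=
  ⟨h'.left_of_isZero ((IsZero.iff_id_eq_zero _).2 ((R.adjFZ.homEquiv _ _).injective
    ((R.T_obj_comp_Z_eq_zero _).trans (R.T_obj_comp_Z_eq_zero _).symm))),
    h''.left_of_iso (asIso (R.adjTe.unit.app X)) hX, inferInstance⟩

include hproj

omit [EnoughInjectives E] in
-- The test objects are `Z U` with `U` in `U'` for `G W`, `T X` with `X` in `U''` for `e W`, and `Z
-- U` with `U` projective for the unit.
theorem mem_rightClass_of_orth {W : E} (H : ∀ Q, R.leftClass U' U'' Q → Orth.{w₃} Q W) :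
    R.rightClass V' V'' W :=
  ⟨h'.mem_right fun _ hU => Orth.right_adjoint_obj R.adjZG (H _ (R.leftClass_Z_obj h' h'' hU)),
    h''.mem_right fun _ hU => Orth.of_left_adjoint_obj R.adjTe (H _ (R.leftClass_T_obj h' h'' hU))
      fun S hS hX => hT S hS (hX ▸ hU),
    R.epi_unit_of_orth hproj fun _ _ => H _ (R.leftClass_Z_obj h' h'' (h'.left_of_projective _))⟩

omit [EnoughInjectives E] in
/-- If `T` is exact on short exact sequences ending in `U''`, then the right class is the right
half of a cotorsion pair. -/
theorem isCotorsionPair_rightClass :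
    IsCotorsionPair.{w₃} (leftPerp.{w₃} (R.rightClass V' V'')) (R.rightClass V' V'') where
  leftPerp_eq := rfl
  rightPerp_eq := by
    funext W
    -- The left class lies in `leftPerp` of the right class, so being orthogonal to the latter perp
    -- is enough for the tests.
    refine propext ⟨fun hW => R.mem_rightClass_of_orth hproj h' h'' hT fun Q hQ => hW Q
      fun W' hW' => R.orth_of_mem_classes h' h'' hQ hW', fun hW Q hQ => hQ W hW⟩

end

section

variable (hH : ∀ S : ShortComplex A, S.ShortExact → V'' S.X₁ → Epi (R.H.map S.g))

include hH h' h''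

omit [EnoughProjectives A] [EnoughProjectives B] [HasExt.{w₃} E] [EnoughProjectives E]
  [EnoughInjectives E] hH in
theorem rightClass_H_obj {X : A} (hX : V'' X) : R.rightClass V' V'' (R.H.obj X) :=
  ⟨h'.right_of_isZero ((IsZero.iff_id_eq_zero _).2 ((R.adjZG.homEquiv _ _).symm.injective
    ((R.Z_obj_comp_H_eq_zero _).trans (R.Z_obj_comp_H_eq_zero _).symm))),
    h''.right_of_iso (asIso (R.adjeH.counit.app X)).symm hX, inferInstance⟩

include hproj

/-- The test objects are `Z V` with `V` in `V'` for `F Q`, `H X` with `X` in `V''` for `e Q`, and `Z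
V` with `V` injective for the counit. -/
theorem mem_leftClass_of_orth {Q : E} (H : ∀ W, R.rightClass V' V'' W → Orth.{w₃} Q W) :
    R.leftClass U' U'' Q :=
  ⟨h'.mem_left fun _ hV => Orth.left_adjoint_obj R.adjFZ (H _ (R.rightClass_Z_obj h' h'' hV)),
    h''.mem_left fun _ hV => Orth.of_right_adjoint_obj R.adjeH
      (H _ (R.rightClass_H_obj h' h'' hV)) fun S hS hX => hH S hS (hX ▸ hV),
    R.mono_counit_of_orth hproj fun _ _ => H _ (R.rightClass_Z_obj h' h''
      (h'.right_of_injective _))⟩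

/-- If `H` is exact on short exact sequences starting in `V''`, then the left class is the left
half of a cotorsion pair. -/
theorem isCotorsionPair_leftClass :
    IsCotorsionPair.{w₃} (R.leftClass U' U'') (rightPerp.{w₃} (R.leftClass U' U'')) where
  rightPerp_eq := rfl
  leftPerp_eq := by
    funext Q
    refine propext ⟨fun hQ => R.mem_leftClass_of_orth hproj h' h'' hH fun W hW => hQ W
      fun Q' hQ' => R.orth_of_mem_classes h' h'' hQ' hW, fun hQ W hW => hW Q hQ⟩

end

section

variable (hT : ∀ S : ShortComplex A, S.ShortExact → U'' S.X₃ → Mono (R.T.map S.f))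
  (hH : ∀ S : ShortComplex A, S.ShortExact → V'' S.X₁ → Epi (R.H.map S.g))

include hproj h' h'' hT hH

theorem isCotorsionPair_classes :
    IsCotorsionPair.{w₃} (R.leftClass U' U'') (R.rightClass V' V'') where
  rightPerp_eq := by
    funext W
    exact propext ⟨fun hW => R.mem_rightClass_of_orth hproj h' h'' hT hW,
      fun hW Q hQ => R.orth_of_mem_classes h' h'' hQ hW⟩
  leftPerp_eq := by
    funext Q
    exact propext ⟨fun hQ => R.mem_leftClass_of_orth hproj h' h'' hH hQ,
      fun hQ W hW => R.orth_of_mem_classes h' h'' hQ hW⟩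

end

omit [EnoughProjectives A] [EnoughInjectives E] in
theorem isHereditary_classes [EnoughInjectives B]
    (hB : IsHereditary U' V') (hA : IsHereditary U'' V'')
    (hT : ∀ S : ShortComplex A, S.ShortExact → U'' S.X₃ → Mono (R.T.map S.f))
    (hH : ∀ S : ShortComplex A, S.ShortExact → V'' S.X₁ → Epi (R.H.map S.g)) :
    IsHereditary (R.leftClass U' U'') (R.rightClass V' V'') where
  kernel_mem S hS h₂ h₃ := by
    have := h₂.2.2
    have := h₃.2.2
    -- `F` is only right exact in general. Here `Ext¹(S.X₃, Z J) = 0` for injective `J`, so an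
    -- embedding of `F S.X₁` in `J` extends over `F S.X₂`.
    have hF : Mono (R.F.map S.f) := by
      let J := Injective.under (R.F.obj S.X₁)
      let j : R.F.obj S.X₁ ⟶ J := Injective.ι _
      have ho : Orth.{w₃} S.X₃ (R.Z.obj J) :=
        .of_shortExact_left (R.shortExact_counit S.X₃)
          (Orth.left_adjoint_obj R.adjTe (.of_isZero_right _ (R.isZero_e_Z _)))
          (R.orth_Z (.of_injective _ _))
      obtain ⟨k, hk⟩ := Orth.extend hS ho (R.adjFZ.homEquiv _ _ j)
      have hk' : R.F.map S.f ≫ (R.adjFZ.homEquiv _ _).symm k = j := by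
        rw [← R.adjFZ.homEquiv_naturality_left_symm, hk, Equiv.symm_apply_apply]
      exact mono_of_mono_fac hk'
    have hFS := map_exact_left R.adjFZ hS
    refine ⟨hB.kernel_mem (S.map R.F) (.mk' hFS.1 hF hFS.2) h₂.1 h₃.1,
      hA.kernel_mem (S.map R.e) (hS.map_of_exact R.e) h₂.2.1 h₃.2.1, ?_⟩
    -- By naturality the counit at `S.X₁` followed by `S.f` equals this map followed by the monic
    -- counit at `S.X₂`.
    have hm : Mono (R.T.map (R.e.map S.f)) := hT _ (hS.map_of_exact R.e) h₃.2.1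
    exact mono_of_mono_fac (R.adjTe.counit_naturality S.f).symm
  cokernel_mem S hS h₁ h₂ := by
    have := h₁.2.2
    have := h₂.2.2
    -- Dually, `Ext¹(Z P, S.X₁) = 0` for projective `P`, so a projective cover of `G S.X₃` lifts to
    -- `G S.X₂`.
    have hG : Epi (R.G.map S.g) := by
      let P := Projective.over (R.G.obj S.X₃)
      let p : P ⟶ R.G.obj S.X₃ := Projective.π _
      have ho : Orth.{w₃} (R.Z.obj P) S.X₁ :=
        .of_shortExact_right (R.shortExact_unit S.X₁) (R.orth_Z (.of_projective _ _))
          (Orth.right_adjoint_obj R.adjeH (.of_isZero_left (R.isZero_e_Z _) _))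
      obtain ⟨k, hk⟩ := Orth.lift hS ho ((R.adjZG.homEquiv _ _).symm p)
      have hk' : R.adjZG.homEquiv _ _ k ≫ R.G.map S.g = p := by
        rw [← R.adjZG.homEquiv_naturality_right, hk, Equiv.apply_symm_apply]
      exact epi_of_epi_fac hk'
    have hGS := map_exact_right R.adjZG hS
    refine ⟨hB.cokernel_mem (S.map R.G) (.mk' hGS.1 hGS.2 hG) h₁.1 h₂.1,
      hA.cokernel_mem (S.map R.e) (hS.map_of_exact R.e) h₁.2.1 h₂.2.1, ?_⟩
    have hm : Epi (R.H.map (R.e.map S.g)) := hH _ (hS.map_of_exact R.e) h₁.2.1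
    exact epi_of_epi_fac (R.adjeH.unit_naturality S.g).symm

end

/-! ### Completeness of the glued pair by three pushouts. -/

section Complete

variable [HasExt.{w₁} A] [HasExt.{w₂} B] (h' : IsCotorsionPair.{w₂} U' V')
  (h'' : IsCotorsionPair.{w₁} U'' V'')

include h' h''

/-- Apply `T` to a special preenvelope `0 → e W → V → U → 0` and push out along the counit. As `e`
inverts the counit, the new object has `e`-part isomorphic to `V`, and the cokernel is `T U`. -/
theorem exists_e_obj_mem (hA : IsComplete U'' V'')
    (hT : ∀ S : ShortComplex A, S.ShortExact → U'' S.X₃ → Mono (R.T.map S.f)) (W : E) :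
    ∃ (W₁ C : E) (i : W ⟶ W₁) (p : W₁ ⟶ C) (h : i ≫ p = 0), V'' (R.e.obj W₁) ∧
      R.leftClass U' U'' C ∧ (ShortComplex.mk i p h).ShortExact := by
  obtain ⟨V, U, a, b, hab, hU, hV, hS⟩ := hA.exists_right (R.e.obj W)
  have hTS := map_exact_left R.adjTe hS
  have hTS' : ((ShortComplex.mk a b hab).map R.T).ShortExact := .mk' hTS.1 (hT _ hS hU) hTS.2
  obtain ⟨W₁, i, r, p, h, hE, sq, -⟩ := hTS'.exists_pushout (R.adjTe.counit.app W)
  change R.T.obj V ⟶ W₁ at r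
  refine ⟨W₁, _, i, p, h, ?_, R.leftClass_T_obj h' h'' hU, hE⟩
  have : IsIso (R.e.map r) := (MorphismProperty.isomorphisms A).of_isPushout (sq.map R.e)
    (inferInstanceAs (IsIso (R.e.map (R.adjTe.counit.app W))))
  exact h''.right_of_iso (asIso (R.adjTe.unit.app V) ≪≫ asIso (R.e.map r)) hV

/-- Instead of requiring an epimorphism `P ⟶ H e W` to factor through `W`, push out `T e P ⟶ P`
along its transpose to `W`. The cokernel `Z F P` has `F P` projective, and `e W` is unchanged up to
isomorphism. -/
theorem exists_epi_unit [EnoughProjectives E]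
    (hproj : ∀ P : E, Projective P → Mono (R.adjTe.counit.app P)) (W : E) :
    ∃ (W₁ C : E) (i : W ⟶ W₁) (p : W₁ ⟶ C) (h : i ≫ p = 0), IsIso (R.e.map i) ∧
      Epi (R.adjeH.unit.app W₁) ∧ R.leftClass U' U'' C ∧ (ShortComplex.mk i p h).ShortExact := by
  let P := Projective.over (R.H.obj (R.e.obj W))
  let q : P ⟶ R.H.obj (R.e.obj W) := Projective.π _
  have hq : Epi q := inferInstanceAs (Epi (Projective.π _))
  have := hproj P inferInstance
  have := R.projective_F_obj P
  let q' := (R.adjeH.homEquiv _ _).symm q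
  obtain ⟨W₁, i, r, p, h, hE, sq, -⟩ :=
    (R.shortExact_counit P).exists_pushout ((R.adjTe.homEquiv _ _).symm q')
  change P ⟶ W₁ at r
  have hi : IsIso (R.e.map i) := (MorphismProperty.isomorphisms A).of_isPushout (sq.map R.e).flip
    (inferInstanceAs (IsIso (R.e.map (R.adjTe.counit.app P))))
  refine ⟨W₁, _, i, p, h, hi, ?_, R.leftClass_Z_obj h' h'' (h'.left_of_projective _), hE⟩
  have hr : r ≫ R.adjeH.unit.app W₁ = q ≫ R.H.map (R.e.map i) := by
    refine ((R.counit_comp_eq_iff_comp_unit_eq r (q' ≫ R.e.map i)).1 ?_).trans ?_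
    · exact sq.w.trans (R.adjTe.homEquiv_naturality_right_symm _ _).symm
    · rw [R.adjeH.homEquiv_naturality_right, Equiv.apply_symm_apply]
  have : Epi (r ≫ R.adjeH.unit.app W₁) := hr ▸ epi_comp q (R.H.map (R.e.map i))
  exact epi_of_epi r _

/-- Replace the subobject `Z G W` by `Z V` for a special preenvelope `G W ⟶ V`. The `e`-part and the
epic unit persist, so the kernel `Z V` of `p` can be compared with `Z G W₁`. -/
theorem exists_G_obj_mem (hB : IsComplete U' V') (W : E) [Epi (R.adjeH.unit.app W)] :
    ∃ (W₁ C : E) (i : W ⟶ W₁) (p : W₁ ⟶ C) (h : i ≫ p = 0), IsIso (R.e.map i) ∧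
      Epi (R.adjeH.unit.app W₁) ∧ V' (R.G.obj W₁) ∧ R.leftClass U' U'' C ∧
      (ShortComplex.mk i p h).ShortExact := by
  obtain ⟨V, U, a, b, hab, hU, hV, hS⟩ := hB.exists_right (R.G.obj W)
  obtain ⟨W₁, i, r, p, h, hE, sq, hrp⟩ := (R.shortExact_unit W).exists_pushout (R.Z.map a)
  change W ⟶ W₁ at r
  obtain ⟨q, hq, hE', -⟩ := (hS.map_of_exact R.Z).of_isPushout sq.flip
  have ha : IsIso (R.e.map (R.Z.map a)) :=
    ⟨0, (R.isZero_e_Z _).eq_of_src _ _, (R.isZero_e_Z _).eq_of_src _ _⟩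
  have hr : IsIso (R.e.map r) := (MorphismProperty.isomorphisms A).of_isPushout (sq.map R.e) ha
  -- This makes `p` a model of the unit of `W₁`, so that its kernel is identified with `Z G W₁`.
  have hp : IsIso (R.e.map p) := by
    have : IsIso (R.e.map r ≫ R.e.map p) := by
      rw [← R.e.map_comp]
      erw [hrp]
      exact inferInstanceAs (IsIso (R.e.map (R.adjeH.unit.app W)))
    exact IsIso.of_isIso_comp_left (R.e.map r) _
  have hp' : Epi p := hE.epi_g
  have hK := R.shortExact_of_epi (p := p) ((R.adjeH.homEquiv _ _).symm.injective
    ((R.isZero_e_Z _).eq_of_src _ _))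
  refine ⟨W₁, _, r, q, hq, hr, ?_, ?_, R.leftClass_Z_obj h' h'' hU, hE'⟩
  · have : Epi (r ≫ R.adjeH.unit.app W₁) := by
      rw [← R.adjeH.unit_naturality]
      exact epi_comp _ _
    exact epi_of_epi r _
  · have := hE.mono_f
    have := hK.mono_f
    exact h'.right_of_iso (R.Z.preimageIso
      (IsLimit.conePointUniqueUpToIso hE.exact.fIsKernel hK.exact.fIsKernel)) hV

theorem isComplete_classes [HasExt.{w₃} E] [EnoughProjectives E]
    (hcot : IsCotorsionPair.{w₃} (R.leftClass U' U'') (R.rightClass V' V''))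
    (hproj : ∀ P : E, Projective P → Mono (R.adjTe.counit.app P))
    (hB : IsComplete U' V') (hA : IsComplete U'' V'')
    (hT : ∀ S : ShortComplex A, S.ShortExact → U'' S.X₃ → Mono (R.T.map S.f)) :
    IsComplete (R.leftClass U' U'') (R.rightClass V' V'') := by
  refine hcot.isComplete_of_exists_right fun W => ?_
  -- The order matters: the last two embeddings do not change `e`, and the last keeps the unit epic.
  -- The cokernel of the composite is an iterated extension of objects of the left class.
  obtain ⟨W₁, C₁, i₁, p₁, w₁, hV, hC₁, hS₁⟩ := R.exists_e_obj_mem h' h'' hA hT W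
  obtain ⟨W₂, C₂, i₂, p₂, w₂, _, _, hC₂, hS₂⟩ := R.exists_epi_unit h' h'' hproj W₁
  obtain ⟨W₃, C₃, i₃, p₃, w₃, _, hW₃, hG, hC₃, hS₃⟩ := R.exists_G_obj_mem h' h'' hB W₂
  obtain ⟨C₄, r₄, w₄, a₄, b₄, w₄', hS₄, hS₄'⟩ := hS₁.exists_comp hS₂
  obtain ⟨C₅, r₅, w₅, a₅, b₅, w₅', hS₅, hS₅'⟩ := hS₄.exists_comp hS₃
  exact ⟨W₃, C₅, _, r₅, w₅, hcot.left_of_shortExact hS₅' (hcot.left_of_shortExact hS₄' hC₁ hC₂) hC₃,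
    ⟨hG, h''.right_of_iso (asIso (R.e.map i₂) ≪≫ asIso (R.e.map i₃)) hV, hW₃⟩, hS₅⟩

end Complete

end Classes
end Recollement

/-! ### Vanishing of the first left derived functor -/

section LeftDerived

variable {C : Type u₁} [Category.{v₁} C] [Abelian C] [HasProjectiveResolutions C]
  {D : Type u₂} [Category.{v₂} D] [Abelian D]

/-- The claim is first shown for the sequence `0 → K → P₀ → S.X₃ → 0` from a projective resolution.
Any other sequence ending in `S.X₃` is a pushout of it, and a left adjoint preserves that pushout.
-/
theorem CategoryTheory.Functor.mono_map_of_isZero_leftDerived_one (Φ : C ⥤ D) [Φ.Additive]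
    [Φ.IsLeftAdjoint] {S : ShortComplex C} (hS : S.ShortExact)
    (h : IsZero ((Φ.leftDerived 1).obj S.X₃)) : Mono (Φ.map S.f) := by
  let P := projectiveResolution S.X₃
  have hex : ((Φ.mapHomologicalComplex _).obj P.complex).ExactAt 1 := by
    rw [HomologicalComplex.exactAt_iff_isZero_homology]
    exact h.of_iso (P.isoLeftDerivedObj Φ 1).symm
  have hex' := (HomologicalComplex.exactAt_iff' _ 2 1 0 (by simp) (by simp)).1 hex
  obtain ⟨p, hp, hdp, hpex⟩ : ∃ (p : P.complex.X 0 ⟶ S.X₃) (_ : Epi p)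
      (h : P.complex.d 1 0 ≫ p = 0), (ShortComplex.mk _ p h).Exact :=
    ⟨P.π.f 0, inferInstanceAs (Epi (P.π.f 0)), P.complex_d_comp_π_f_zero, P.exact₀⟩
  have hK := ShortComplex.ShortExact.of_epi p
  let d : P.complex.X 1 ⟶ Limits.kernel p := kernel.lift p _ hdp
  have hd : Epi d := (ShortComplex.exact_iff_epi_kernel_lift _).1 hpex
  have hdι : d ≫ kernel.ι p = P.complex.d 1 0 := kernel.lift_ι _ _ _
  have hdd : P.complex.d 2 1 ≫ d = 0 := by
    rw [← cancel_mono (kernel.ι p), Category.assoc, hdι, P.complex.d_comp_d, zero_comp]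
  -- An element of `Φ K` killed in `Φ P₀` lifts to a cycle in `Φ P₁`. This is a boundary, and
  -- boundaries vanish in `Φ K`.
  have hmono : Mono (Φ.map (kernel.ι p)) := by
    refine Preadditive.mono_of_cancel_zero _ fun {T} t ht => ?_
    obtain ⟨T', π, _, x, hx⟩ := surjective_up_to_refinements_of_epi (Φ.map d) t
    have hx' : x ≫ Φ.map (P.complex.d 1 0) = 0 := by
      rw [← hdι, Φ.map_comp, ← Category.assoc, ← hx, Category.assoc, ht, comp_zero]
    obtain ⟨T'', π', _, y, hy⟩ := hex'.exact_up_to_refinements x hx'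
    change T'' ⟶ Φ.obj (P.complex.X 2) at y
    have hy' : π' ≫ x = y ≫ Φ.map (P.complex.d 2 1) := hy
    rw [← cancel_epi (π' ≫ π), Category.assoc, hx, ← Category.assoc, hy', Category.assoc,
      ← Φ.map_comp, hdd, Φ.map_zero, comp_zero, comp_zero]
  have := hS.epi_g
  let l : P.complex.X 0 ⟶ S.X₂ := Projective.factorThru p S.g
  have hl : l ≫ S.g = p := Projective.factorThru_comp _ _
  have hk : (kernel.ι p ≫ l) ≫ S.g = 0 := by rw [Category.assoc, hl, kernel.condition]
  have := hS.mono_f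
  let k : Limits.kernel p ⟶ S.X₁ := hS.exact.lift _ hk
  have hkf : k ≫ S.f = kernel.ι p ≫ l := hS.exact.lift_f _ _
  obtain ⟨E, i, r, q, hiq, hE, sq, hrq⟩ := hK.exists_pushout k
  let m : E ⟶ S.X₂ := sq.desc l S.f hkf.symm
  have hm : i ≫ m = S.f := sq.inr_desc _ _ _
  have hmg : m ≫ S.g = q := by
    apply sq.hom_ext
    · rw [← Category.assoc, sq.inl_desc, hl, hrq]
    · rw [← Category.assoc, hm, S.zero, hiq]
  let ψ : ShortComplex.mk i q hiq ⟶ S :=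
    { τ₁ := 𝟙 _
      τ₂ := m
      τ₃ := 𝟙 _
      comm₁₂ := (Category.id_comp _).trans hm.symm
      comm₂₃ := hmg.trans (Category.comp_id _).symm }
  have : IsIso ψ.τ₁ := inferInstanceAs (IsIso (𝟙 _))
  have : IsIso ψ.τ₃ := inferInstanceAs (IsIso (𝟙 _))
  -- The short five lemma identifies `S` with the pushout sequence.
  have hmiso : IsIso m := ShortComplex.isIso₂_of_shortExact_of_isIso₁₃ ψ hE hS
  have : PreservesColimits Φ :=
    (Adjunction.ofIsLeftAdjoint Φ).leftAdjoint_preservesColimits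
  have hi : Mono (Φ.map i) :=
    (MorphismProperty.monomorphisms D).of_isPushout (sq.map Φ).flip hmono
  rw [← hm, Φ.map_comp]
  exact mono_comp _ _

end LeftDerived

/-! ### Maps out of the balanced tensor product -/

namespace BalTensor

section

variable {R M X P : Type*} [Ring R] [AddCommGroup M] [Module Rᵐᵒᵖ M]
  [AddCommGroup X] [Module R X] [AddCommGroup P]

/-- The `S`-linear map out of `M ⊗_R X` induced by a function of two variables. -/
def liftLinear {S : Type*} [Ring S] [Module S M] [SMulCommClass S Rᵐᵒᵖ M] [Module S P]
    (F : M → X → P) (add_left : ∀ m m' x, F (m + m') x = F m x + F m' x)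
    (add_right : ∀ m x x', F m (x + x') = F m x + F m x')
    (balanced : ∀ m (r : R) x, F (op r • m) x = F m (r • x))
    (smul_left : ∀ (s : S) m x, F (s • m) x = s • F m x) : BalTensor R M X →ₗ[S] P where
  toFun := lift (AddMonoidHom.mk' (fun m => AddMonoidHom.mk' (F m) (add_right m))
    fun m m' => by ext x; exact add_left m m' x) balanced
  map_add' s t := map_add _ s t
  map_smul' s t := by
    induction t using induction_on with
    | zero => simp
    | tmul m x => exact smul_left s m x
    | add t t' ht ht' => rw [smul_add, map_add, ht, ht', map_add, smul_add]

theorem linearMap_ext {S : Type*} [Ring S] [Module S M] [SMulCommClass S Rᵐᵒᵖ M] [Module S P]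
    {F G : BalTensor R M X →ₗ[S] P} (h : ∀ m x, F (tmul R m x) = G (tmul R m x)) : F = G := by
  ext t
  induction t using induction_on with
  | zero => rw [map_zero, map_zero]
  | tmul m x => exact h m x
  | add s t hs ht => rw [map_add, map_add, hs, ht]

end

/-- Additive maps `M → G` as a left `R`-module, for a right `R`-module `M`. -/
def AddHom (_R M G : Type*) [AddCommGroup M] [AddCommGroup G] : Type _ := M →+ G

namespace AddHom

variable {R M G : Type*} [Ring R] [AddCommGroup M] [Module Rᵐᵒᵖ M] [AddCommGroup G]

instance : AddCommGroup (AddHom R M G) := inferInstanceAs (AddCommGroup (M →+ G))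

instance : FunLike (AddHom R M G) M G := inferInstanceAs (FunLike (M →+ G) M G)

instance : AddMonoidHomClass (AddHom R M G) M G := inferInstanceAs (AddMonoidHomClass (M →+ G) M G)

omit [Ring R] [Module Rᵐᵒᵖ M] in
@[ext] theorem ext {h k : AddHom R M G} (H : ∀ m, h m = k m) : h = k := AddMonoidHom.ext H

instance : Module R (AddHom R M G) where
  smul r h := AddMonoidHom.comp h (DistribSMul.toAddMonoidHom M (op r))
  one_smul h := ext fun m => congrArg h (one_smul Rᵐᵒᵖ m)
  mul_smul r s h := ext fun m => congrArg h (mul_smul (op s) (op r) m)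
  smul_zero _ := rfl
  smul_add _ _ _ := rfl
  add_smul r s h := ext fun m => (congrArg h (add_smul (op r) (op s) m)).trans (map_add h _ _)
  zero_smul h := ext fun m => (congrArg h (zero_smul Rᵐᵒᵖ m)).trans (map_zero h)

omit [Ring R] [Module Rᵐᵒᵖ M] in
theorem add_apply (h k : AddHom R M G) (m : M) : (h + k) m = h m + k m := rfl

theorem smul_apply (r : R) (h : AddHom R M G) (m : M) : (r • h) m = h (op r • m) := rfl

end AddHom

/-- Additive maps `M ⊗_R X → G` are `R`-linear maps `X → Hom_ℤ(M, G)`. -/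
def curryEquiv {R M X G : Type*} [Ring R] [AddCommGroup M] [Module Rᵐᵒᵖ M] [AddCommGroup X]
    [Module R X] [AddCommGroup G] :
    (BalTensor R M X →+ G) ≃ (X →ₗ[R] AddHom R M G) where
  toFun k :=
    { toFun := fun x => AddMonoidHom.mk' (fun m => k (tmul R m x))
        fun m m' => by rw [add_tmul, map_add]
      map_add' := fun x y => AddHom.ext fun m =>
        (congrArg k (tmul_add R m x y)).trans (map_add k _ _)
      map_smul' := fun r x => AddHom.ext fun m => congrArg k (smul_tmul R m r x).symm }
  invFun k := lift
    (AddMonoidHom.mk' (fun m => AddMonoidHom.mk' (fun x => k x m)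
      fun x y => by rw [map_add, AddHom.add_apply])
      fun m m' => AddMonoidHom.ext fun x => map_add (k x) m m')
    fun m r x => by
      change k x (op r • m) = k (r • x) m
      rw [LinearMap.map_smul, AddHom.smul_apply]
  left_inv k := addHom_ext fun m x => rfl
  right_inv k := rfl

end BalTensor

/-! ### Vanishing of `Tor₁` and injectivity of `M ⊗_R -`. -/

section TorOne

variable (R M : Type u) [Ring R] [AddCommGroup M] [Module Rᵐᵒᵖ M]

/-- The adjunction between `M ⊗_R -` and `Hom_ℤ(M, -)` on morphisms. -/
def balTensorHomEquiv (X : ModuleCat.{u} R) (G : AddCommGrpCat.{u}) :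
    ((balTensorFunctor R M).obj X ⟶ G) ≃ (X ⟶ ModuleCat.of R (BalTensor.AddHom R M G)) where
  toFun k := ModuleCat.ofHom (BalTensor.curryEquiv k.hom)
  invFun k := AddCommGrpCat.ofHom (BalTensor.curryEquiv.symm k.hom)
  left_inv k := by
    ext1
    exact BalTensor.curryEquiv.symm_apply_apply k.hom
  right_inv k := rfl

instance : (balTensorFunctor R M).IsLeftAdjoint :=
  ⟨_, ⟨Adjunction.adjunctionOfEquivRight (F := balTensorFunctor R M)
    (G_obj := fun G => ModuleCat.of R (BalTensor.AddHom R M G)) (balTensorHomEquiv R M)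
    fun _ _ _ _ _ => by ext1; rfl⟩⟩

variable {R}

theorem map_injective_of_torOne {S : ShortComplex (ModuleCat.{u} R)} (hS : S.ShortExact)
    (h : Subsingleton (torOne R M S.X₃)) :
    Function.Injective (BalTensor.map (LinearMap.id : M →ₗ[Rᵐᵒᵖ] M) S.f.hom) := by
  have := (balTensorFunctor R M).mono_map_of_isZero_leftDerived_one hS
    (AddCommGrpCat.isZero_of_subsingleton (torOne R M S.X₃))
  exact (AddCommGrpCat.mono_iff_injective _).1 this

end TorOne

namespace MoritaContext

variable {A B M N : Type u} [Ring A] [Ring B] [AddCommGroup M] [AddCommGroup N]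
  [Module B M] [Module Aᵐᵒᵖ M] [SMulCommClass B Aᵐᵒᵖ M]
  [Module A N] [Module Bᵐᵒᵖ N] [SMulCommClass A Bᵐᵒᵖ N]
  {c : MoritaContext A B M N}

namespace Quad

/-! ### The category of quadruples -/

/-- Morphisms of quadruples. -/
@[ext] structure Hom (P Q : c.Quad) where
  α : P.X →ₗ[A] Q.X
  β : P.Y →ₗ[B] Q.Y
  comm_f : ∀ m x, β (P.f (BalTensor.tmul A m x)) = Q.f (BalTensor.tmul A m (α x))
  comm_g : ∀ n y, α (P.g (BalTensor.tmul B n y)) = Q.g (BalTensor.tmul B n (β y))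

@[simps] instance : Category c.Quad where
  Hom := Hom
  id Q := ⟨LinearMap.id, LinearMap.id, fun _ _ => rfl, fun _ _ => rfl⟩
  comp h k := ⟨k.α ∘ₗ h.α, k.β ∘ₗ h.β, fun m x => by simp [h.comm_f, k.comm_f],
    fun n y => by simp [h.comm_g, k.comm_g]⟩

theorem hom_ext {P Q : c.Quad} {h k : P ⟶ Q} (hα : ∀ x, h.α x = k.α x) (hβ : ∀ y, h.β y = k.β y) :
    h = k :=
  Hom.ext (LinearMap.ext hα) (LinearMap.ext hβ)

variable (c) in
/-- The functor `(X, Y, f, g) ↦ X`. -/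
def functorX : c.Quad ⥤ ModuleCat.{u} A where
  obj Q := Q.X
  map h := ModuleCat.ofHom h.α

/-- An isomorphism of quadruples from bijective components. -/
def isoMk {P Q : c.Quad} (a : P.X ≃ₗ[A] Q.X) (b : P.Y ≃ₗ[B] Q.Y)
    (hf : ∀ m x, b (P.f (BalTensor.tmul A m x)) = Q.f (BalTensor.tmul A m (a x)))
    (hg : ∀ n y, a (P.g (BalTensor.tmul B n y)) = Q.g (BalTensor.tmul B n (b y))) : P ≅ Q where
  hom := ⟨a, b, hf, hg⟩
  inv := ⟨a.symm, b.symm, fun m x => b.injective (by simp [hf]),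
    fun n y => a.injective (by simp [hg])⟩
  hom_inv_id := hom_ext a.symm_apply_apply b.symm_apply_apply
  inv_hom_id := hom_ext a.apply_symm_apply b.apply_symm_apply

theorem epi_of_surjective {P Q : c.Quad} (h : P ⟶ Q) (hα : Function.Surjective h.α)
    (hβ : Function.Surjective h.β) : Epi h where
  left_cancellation k l hkl := by
    refine hom_ext (hα.forall.2 fun x => ?_) (hβ.forall.2 fun y => ?_)
    · exact LinearMap.congr_fun (congrArg Hom.α hkl) x
    · exact LinearMap.congr_fun (congrArg Hom.β hkl) y

theorem mono_of_injective {P Q : c.Quad} (h : P ⟶ Q) (hα : Function.Injective h.α)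
    (hβ : Function.Injective h.β) : Mono h where
  right_cancellation k l hkl := by
    refine hom_ext (fun x => hα ?_) (fun y => hβ ?_)
    · exact LinearMap.congr_fun (congrArg Hom.α hkl) x
    · exact LinearMap.congr_fun (congrArg Hom.β hkl) y

/-! ### Quadruples and `Λ`-modules -/

namespace Hom

/-- The `Λ`-linear map of a morphism of quadruples. -/
def toLinearMap {P Q : c.Quad} (h : Hom P Q) : P.Col →ₗ[c.Lam] Q.Col where
  toFun u := ⟨h.α u.x, h.β u.y⟩
  map_add' u v := by ext <;> simp
  map_smul' l u := by ext <;> simp [h.comm_f, h.comm_g]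

end Hom

variable (c) in
/-- The functor from quadruples to `Λ`-modules. -/
def toLam : c.Quad ⥤ ModuleCat.{u} c.Lam where
  obj Q := Q.toLamModule
  map h := ModuleCat.ofHom h.toLinearMap

instance : (toLam c).Faithful where
  map_injective {P Q h k} hkl := by
    have H (u : P.Col) : h.toLinearMap u = k.toLinearMap u :=
      LinearMap.congr_fun (congrArg ModuleCat.Hom.hom hkl) u
    exact hom_ext (fun x => congrArg Col.x (H ⟨x, 0⟩)) (fun y => congrArg Col.y (H ⟨0, y⟩))

/-- The diagonal idempotent of `Λ` fixes the column, so the image is fixed by it too. -/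
theorem Col.map_mk_left {P Q : c.Quad} (k : P.Col →ₗ[c.Lam] Q.Col) (x : P.X) :
    k ⟨x, 0⟩ = ⟨(k ⟨x, 0⟩).x, 0⟩ := by
  have h : (⟨x, 0⟩ : P.Col) = (⟨1, 0, 0, 0⟩ : c.Lam) • ⟨x, 0⟩ := by ext <;> simp
  conv_lhs => rw [h, map_smul]
  ext <;> simp

theorem Col.map_mk_right {P Q : c.Quad} (k : P.Col →ₗ[c.Lam] Q.Col) (y : P.Y) :
    k ⟨0, y⟩ = ⟨0, (k ⟨0, y⟩).y⟩ := by
  have h : (⟨0, y⟩ : P.Col) = (⟨0, 0, 0, 1⟩ : c.Lam) • ⟨0, y⟩ := by ext <;> simp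
  conv_lhs => rw [h, map_smul]
  ext <;> simp

/-- The morphism of quadruples of a `Λ`-linear map. -/
def ofLinearMap {P Q : c.Quad} (k : P.Col →ₗ[c.Lam] Q.Col) : P ⟶ Q where
  α :=
    { toFun := fun x => (k ⟨x, 0⟩).x
      map_add' := fun x x' => by
        rw [← Col.add_x, ← map_add]
        congr 2
        ext <;> simp
      map_smul' := fun a x => by
        have h : (⟨a • x, 0⟩ : P.Col) = (⟨a, 0, 0, 0⟩ : c.Lam) • ⟨x, 0⟩ := by ext <;> simp
        rw [h, map_smul]
        simp }
  β :=
    { toFun := fun y => (k ⟨0, y⟩).y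
      map_add' := fun y y' => by
        rw [← Col.add_y, ← map_add]
        congr 2
        ext <;> simp
      map_smul' := fun b y => by
        have h : (⟨0, b • y⟩ : P.Col) = (⟨0, 0, 0, b⟩ : c.Lam) • ⟨0, y⟩ := by ext <;> simp
        rw [h, map_smul]
        simp }
  comm_f m x := by
    have h : (⟨0, P.f (BalTensor.tmul A m x)⟩ : P.Col) = (⟨0, 0, m, 0⟩ : c.Lam) • ⟨x, 0⟩ := by
      ext <;> simp
    change (k _).y = _
    rw [h, map_smul]
    simp
  comm_g n y := by
    have h : (⟨P.g (BalTensor.tmul B n y), 0⟩ : P.Col) = (⟨0, n, 0, 0⟩ : c.Lam) • ⟨0, y⟩ := by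
      ext <;> simp
    change (k _).x = _
    rw [h, map_smul]
    simp

instance : (toLam c).Full where
  map_surjective {P Q} k := by
    refine ⟨ofLinearMap k.hom, ?_⟩
    ext u
    change (ofLinearMap k.hom).toLinearMap u = k.hom u
    obtain ⟨x, y⟩ := u
    have h : (⟨x, y⟩ : P.Col) = ⟨x, 0⟩ + ⟨0, y⟩ := by ext <;> simp
    conv_rhs => rw [h]
    erw [map_add k.hom]
    erw [Col.map_mk_left k.hom, Col.map_mk_right k.hom]
    ext
    · exact (add_zero _).symm
    · exact (zero_add _).symm

end Quad

/-! ### The quadruple of a `Λ`-module -/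

section OfModule

variable (Z : Type u) [AddCommGroup Z] [Module c.Lam Z]

/-- The upper component of a `Λ`-module. -/
def upper : AddSubgroup Z where
  carrier := {z | (⟨1, 0, 0, 0⟩ : c.Lam) • z = z}
  add_mem' {z z'} hz hz' := by
    change _ • (z + z') = z + z'
    rw [smul_add, hz, hz']
  zero_mem' := smul_zero _
  neg_mem' {z} hz := by
    change _ • (-z) = -z
    rw [smul_neg, hz]

/-- The lower component of a `Λ`-module. -/
def lower : AddSubgroup Z where
  carrier := {z | (⟨0, 0, 0, 1⟩ : c.Lam) • z = z}
  add_mem' {z z'} hz hz' := by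
    change _ • (z + z') = z + z'
    rw [smul_add, hz, hz']
  zero_mem' := smul_zero _
  neg_mem' {z} hz := by
    change _ • (-z) = -z
    rw [smul_neg, hz]

variable {Z} in
theorem smul_mem_upper {l : c.Lam} (hl : (⟨1, 0, 0, 0⟩ : c.Lam) * l = l) (z : Z) :
    l • z ∈ upper (c := c) Z := by
  change _ • _ = _
  rw [← mul_smul, hl]

variable {Z} in
theorem smul_mem_lower {l : c.Lam} (hl : (⟨0, 0, 0, 1⟩ : c.Lam) * l = l) (z : Z) :
    l • z ∈ lower (c := c) Z := by
  change _ • _ = _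
  rw [← mul_smul, hl]

instance : Module A (upper (c := c) Z) where
  smul a z := ⟨(⟨a, 0, 0, 0⟩ : c.Lam) • (z : Z), smul_mem_upper (by ext <;> simp) _⟩
  one_smul z := Subtype.ext z.2
  mul_smul a a' z := Subtype.ext (by
    change (_ : c.Lam) • (z : Z) = (_ : c.Lam) • (_ : c.Lam) • (z : Z)
    rw [← mul_smul]
    congr 1
    ext <;> simp)
  smul_zero a := Subtype.ext (smul_zero _)
  smul_add a z z' := Subtype.ext (smul_add _ _ _)
  add_smul a a' z := Subtype.ext (by
    change (_ : c.Lam) • (z : Z) = (_ : c.Lam) • (z : Z) + (_ : c.Lam) • (z : Z)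
    rw [← add_smul]
    congr 1
    ext <;> simp)
  zero_smul z := Subtype.ext (zero_smul c.Lam (z : Z))

instance : Module B (lower (c := c) Z) where
  smul b z := ⟨(⟨0, 0, 0, b⟩ : c.Lam) • (z : Z), smul_mem_lower (by ext <;> simp) _⟩
  one_smul z := Subtype.ext z.2
  mul_smul a a' z := Subtype.ext (by
    change (_ : c.Lam) • (z : Z) = (_ : c.Lam) • (_ : c.Lam) • (z : Z)
    rw [← mul_smul]
    congr 1
    ext <;> simp)
  smul_zero a := Subtype.ext (smul_zero _)
  smul_add a z z' := Subtype.ext (smul_add _ _ _)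
  add_smul a a' z := Subtype.ext (by
    change (_ : c.Lam) • (z : Z) = (_ : c.Lam) • (z : Z) + (_ : c.Lam) • (z : Z)
    rw [← add_smul]
    congr 1
    ext <;> simp)
  zero_smul z := Subtype.ext (zero_smul c.Lam (z : Z))

/-- The quadruple of a `Λ`-module. -/
def quadOf : c.Quad where
  X := ModuleCat.of A (upper (c := c) Z)
  Y := ModuleCat.of B (lower (c := c) Z)
  f := BalTensor.liftLinear (P := lower (c := c) Z)
    (fun m (x : upper (c := c) Z) =>
      ⟨(⟨0, 0, m, 0⟩ : c.Lam) • (x : Z), smul_mem_lower (by ext <;> simp) _⟩)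
    (fun m m' x => Subtype.ext (by
      change (_ : c.Lam) • (x : Z) = (_ : c.Lam) • (x : Z) + (_ : c.Lam) • (x : Z)
      rw [← add_smul]
      congr 1
      ext <;> simp))
    (fun m x x' => Subtype.ext (smul_add _ _ _))
    (fun m a x => Subtype.ext (by
      change (_ : c.Lam) • (x : Z) = (_ : c.Lam) • (_ : c.Lam) • (x : Z)
      rw [← mul_smul]
      congr 1
      ext <;> simp))
    (fun b m x => Subtype.ext (by
      change (_ : c.Lam) • (x : Z) = (_ : c.Lam) • (_ : c.Lam) • (x : Z)
      rw [← mul_smul]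
      congr 1
      ext <;> simp))
  g := BalTensor.liftLinear (P := upper (c := c) Z)
    (fun n (y : lower (c := c) Z) =>
      ⟨(⟨0, n, 0, 0⟩ : c.Lam) • (y : Z), smul_mem_upper (by ext <;> simp) _⟩)
    (fun m m' x => Subtype.ext (by
      change (_ : c.Lam) • (x : Z) = (_ : c.Lam) • (x : Z) + (_ : c.Lam) • (x : Z)
      rw [← add_smul]
      congr 1
      ext <;> simp))
    (fun m x x' => Subtype.ext (smul_add _ _ _))
    (fun m a x => Subtype.ext (by
      change (_ : c.Lam) • (x : Z) = (_ : c.Lam) • (_ : c.Lam) • (x : Z)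
      rw [← mul_smul]
      congr 1
      ext <;> simp))
    (fun b m x => Subtype.ext (by
      change (_ : c.Lam) • (x : Z) = (_ : c.Lam) • (_ : c.Lam) • (x : Z)
      rw [← mul_smul]
      congr 1
      ext <;> simp))
  g_f n m x := Subtype.ext (by
    change (_ : c.Lam) • (_ : c.Lam) • ((x : upper (c := c) Z) : Z) =
      (_ : c.Lam) • ((x : upper (c := c) Z) : Z)
    rw [← mul_smul]
    congr 1
    ext <;> simp)
  f_g m n y := Subtype.ext (by
    change (_ : c.Lam) • (_ : c.Lam) • ((y : lower (c := c) Z) : Z) =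
      (_ : c.Lam) • ((y : lower (c := c) Z) : Z)
    rw [← mul_smul]
    congr 1
    ext <;> simp)

/-- A `Λ`-module is the module of columns of its quadruple. -/
def colQuadOfEquiv : (quadOf (c := c) Z).Col ≃ₗ[c.Lam] Z where
  toFun u := (upper (c := c) Z).subtype u.x + (lower (c := c) Z).subtype u.y
  map_add' u v := add_add_add_comm _ _ _ _
  map_smul' l u := by
    obtain ⟨x, y⟩ := u
    obtain ⟨x, hx⟩ := x
    obtain ⟨y, hy⟩ := y
    change ((_ : c.Lam) • x + (_ : c.Lam) • y) + ((_ : c.Lam) • x + (_ : c.Lam) • y) = l • (x + y)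
    have hx' : (⟨1, 0, 0, 0⟩ : c.Lam) • x = x := hx
    have hy' : (⟨0, 0, 0, 1⟩ : c.Lam) • y = y := hy
    conv_rhs => rw [smul_add, ← hx', ← hy', ← mul_smul, ← mul_smul]
    rw [add_add_add_comm, ← add_smul, ← add_smul]
    congr 2 <;> ext <;> simp
  invFun z := ⟨⟨(⟨1, 0, 0, 0⟩ : c.Lam) • z, smul_mem_upper (by ext <;> simp) _⟩,
    ⟨(⟨0, 0, 0, 1⟩ : c.Lam) • z, smul_mem_lower (by ext <;> simp) _⟩⟩
  left_inv u := by
    obtain ⟨⟨x, hx⟩, ⟨y, hy⟩⟩ := u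
    have hx' : (⟨1, 0, 0, 0⟩ : c.Lam) • x = x := hx
    have hy' : (⟨0, 0, 0, 1⟩ : c.Lam) • y = y := hy
    refine Quad.Col.ext (Subtype.ext ?_) (Subtype.ext ?_)
    · change (_ : c.Lam) • (x + y) = x
      conv_lhs => rw [← hy', smul_add, hx', ← mul_smul]
      convert add_zero x
      convert zero_smul c.Lam y
      ext <;> simp
    · change (_ : c.Lam) • (x + y) = y
      conv_lhs => rw [← hx', smul_add, hy', ← mul_smul]
      convert zero_add y
      convert zero_smul c.Lam x
      ext <;> simp
  right_inv z := by
    change (_ : c.Lam) • z + (_ : c.Lam) • z = z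
    rw [← add_smul]
    convert one_smul c.Lam z
    ext <;> simp

end OfModule

namespace Quad

instance : (toLam c).EssSurj where
  mem_essImage Z := ⟨quadOf Z, ⟨(colQuadOfEquiv Z).toModuleIso⟩⟩

instance : (toLam c).IsEquivalence where

end Quad

end MoritaContext

namespace MoritaContext

variable {A B M N : Type u} [Ring A] [Ring B] [AddCommGroup M] [AddCommGroup N]
  [Module B M] [Module Aᵐᵒᵖ M] [SMulCommClass B Aᵐᵒᵖ M]
  [Module A N] [Module Bᵐᵒᵖ N] [SMulCommClass A Bᵐᵒᵖ N]

/-! ### The adjoints of `(X, Y, f, g) ↦ X` -/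

/-- `Hom_A(N, X)` as a left `B`-module, with `(b h) n = h (n b)`. -/
def LeftHom (A _B N X : Type*) [Ring A] [AddCommGroup N] [Module A N] [AddCommGroup X]
    [Module A X] : Type _ := N →ₗ[A] X

namespace LeftHom

variable {X : Type*} [AddCommGroup X] [Module A X]

instance : AddCommGroup (LeftHom A B N X) := inferInstanceAs (AddCommGroup (N →ₗ[A] X))

instance : FunLike (LeftHom A B N X) N X := inferInstanceAs (FunLike (N →ₗ[A] X) N X)

instance : LinearMapClass (LeftHom A B N X) A N X :=
  inferInstanceAs (LinearMapClass (N →ₗ[A] X) A N X)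

omit [Ring B] [Module Bᵐᵒᵖ N] [SMulCommClass A Bᵐᵒᵖ N] in
@[ext] theorem ext {h k : LeftHom A B N X} (H : ∀ n, h n = k n) : h = k := LinearMap.ext H

instance : Module B (LeftHom A B N X) where
  smul b h := LinearMap.comp (h : N →ₗ[A] X)
    ({ toFun := fun n => op b • n
       map_add' := smul_add _
       map_smul' := fun a n => (smul_comm a (op b) n).symm } : N →ₗ[A] N)
  one_smul h := ext fun m => congrArg h (one_smul Bᵐᵒᵖ m)
  mul_smul r s h := ext fun m => congrArg h (mul_smul (op s) (op r) m)
  smul_zero _ := rfl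
  smul_add _ _ _ := rfl
  add_smul r s h := ext fun m => (congrArg h (add_smul (op r) (op s) m)).trans (map_add h _ _)
  zero_smul h := ext fun m => (congrArg h (zero_smul Bᵐᵒᵖ m)).trans (map_zero h)

end LeftHom

section Action

variable (c : MoritaContext A B M N) (X : Type*) [AddCommGroup X] [Module A X]

/-- The map `m ⊗ x ↦ ψ(n ⊗ m) x`. -/
def ψActLeft (n : N) : BalTensor A M X →+ X :=
  BalTensor.lift
    (AddMonoidHom.mk' (fun m => AddMonoidHom.mk' (fun x => c.ψ (BalTensor.tmul B n m) • x)
      (smul_add _)) fun m m' => by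
        ext x
        simp [BalTensor.tmul_add, add_smul])
    fun m a x => by simp [c.ψ_right, mul_smul]

@[simp] theorem ψActLeft_tmul (n : N) (m : M) (x : X) :
    c.ψActLeft X n (BalTensor.tmul A m x) = c.ψ (BalTensor.tmul B n m) • x := rfl

/-- The map `N ⊗_B (M ⊗_A X) → X`, `n ⊗ (m ⊗ x) ↦ ψ(n ⊗ m) x`. -/
def ψAct : BalTensor B N (BalTensor A M X) →ₗ[A] X :=
  BalTensor.liftLinear (fun n t => c.ψActLeft X n t)
    (fun n n' t => by
      induction t using BalTensor.induction_on with
      | zero => simp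
      | tmul m x => simp [BalTensor.add_tmul, add_smul]
      | add s t hs ht => simp only [map_add, hs, ht]; abel)
    (fun n t t' => map_add _ _ _)
    (fun n b t => by
      induction t using BalTensor.induction_on with
      | zero => simp
      | tmul m x => simp [BalTensor.smul_tmul_left, BalTensor.smul_tmul]
      | add s t hs ht => simp only [map_add, smul_add, hs, ht])
    (fun a n t => by
      induction t using BalTensor.induction_on with
      | zero => simp
      | tmul m x => simp [← BalTensor.smul_tmul_left, mul_smul]
      | add s t hs ht => simp only [map_add, smul_add, hs, ht])

theorem ψAct_tmul (n : N) (t : BalTensor A M X) :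
    c.ψAct X (BalTensor.tmul B n t) = c.ψActLeft X n t := rfl

/-- By `assoc_M`; this is the compatibility `f_g` for `(X, M ⊗_A X)`. -/
theorem tmul_ψAct (m : M) (n : N) (t : BalTensor A M X) :
    BalTensor.tmul A m (c.ψAct X (BalTensor.tmul B n t)) = c.φ (BalTensor.tmul A m n) • t := by
  induction t using BalTensor.induction_on with
  | zero => simp
  | tmul m' x =>
    rw [ψAct_tmul, ψActLeft_tmul, ← BalTensor.smul_tmul, c.assoc_M, BalTensor.smul_tmul_left]
  | add s t hs ht => rw [BalTensor.tmul_add, map_add, BalTensor.tmul_add, hs, ht, smul_add]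

/-- Evaluation at the second variable: `M ⊗_A X → Hom_A(N, X)`, `m ⊗ x ↦ (n ↦ ψ(n ⊗ m) x)`. -/
def ψHom : BalTensor A M X →ₗ[B] LeftHom A B N X :=
  BalTensor.liftLinear
    (fun m x => (LinearMap.toSpanSingleton A X x) ∘ₗ
      ({ toFun := fun n => c.ψ (BalTensor.tmul B n m)
         map_add' := fun n n' => by rw [BalTensor.add_tmul, map_add]
         map_smul' := fun a n => by
          rw [← BalTensor.smul_tmul_left, map_smul, RingHom.id_apply] } : N →ₗ[A] A))
    (fun m m' x => LeftHom.ext fun n => by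
      change c.ψ _ • x = c.ψ _ • x + c.ψ _ • x
      rw [BalTensor.tmul_add, map_add, add_smul])
    (fun m x x' => LeftHom.ext fun n => smul_add (c.ψ (BalTensor.tmul B n m)) x x')
    (fun m a x => LeftHom.ext fun n => (congrArg (· • x) (c.ψ_right n m a)).trans (mul_smul _ _ _))
    (fun b m x => LeftHom.ext fun n => congrArg (c.ψ · • x) (BalTensor.smul_tmul B n b m).symm)

variable (A B N) in
/-- The evaluation map `N ⊗_B Hom_A(N, X) → X`. -/
def evalHom (X : Type*) [AddCommGroup X] [Module A X] :
    BalTensor B N (LeftHom A B N X) →ₗ[A] X :=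
  BalTensor.liftLinear (fun n h => h n) (fun n n' h => map_add h n n') (fun _ _ _ => rfl)
    (fun _ _ _ => rfl) (fun a n h => map_smul h a n)

/-- By `assoc_N`; this is the compatibility `f_g` for `(X, Hom_A(N, X))`. -/
theorem ψHom_tmul_eval (m : M) (n : N) (h : LeftHom A B N X) :
    c.ψHom X (BalTensor.tmul A m (evalHom A B N X (BalTensor.tmul B n h))) =
      c.φ (BalTensor.tmul A m n) • h := LeftHom.ext fun n' => by
  change c.ψ (BalTensor.tmul B n' m) • h n = h (op (c.φ (BalTensor.tmul A m n)) • n')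
  rw [c.assoc_N, map_smul]

end Action

namespace Quad

variable (c : MoritaContext A B M N)

/-- The quadruple `(X, M ⊗_A X, 1, ψ ⊗ X)`. -/
def tensor (X : ModuleCat.{u} A) : c.Quad where
  X := X
  Y := ModuleCat.of B (BalTensor A M X)
  f := LinearMap.id
  g := c.ψAct X
  g_f _ _ _ := rfl
  f_g m n t := c.tmul_ψAct X m n t

variable {c} in
/-- The map `M ⊗_A X → Y` induced by a map from `X` to the first component of `(X', Y, f, g)`. -/
def extendMap {X : Type*} [AddCommGroup X] [Module A X] (Q : c.Quad) (k : X →ₗ[A] Q.X) :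
    BalTensor A M X →ₗ[B] Q.Y :=
  BalTensor.liftLinear (fun m x => Q.f (BalTensor.tmul A m (k x)))
    (fun m m' x => by rw [BalTensor.add_tmul, map_add])
    (fun m x x' => by rw [map_add, BalTensor.tmul_add, map_add])
    (fun m a x => by rw [BalTensor.smul_tmul, map_smul])
    (fun b m x => by rw [← BalTensor.smul_tmul_left, map_smul])

variable {c} in
-- The relation `g_f` of `Q` makes a map on first components extend to a morphism of quadruples.
theorem map_ψAct {X : Type*} [AddCommGroup X] [Module A X] (Q : c.Quad) (k : X →ₗ[A] Q.X) (n : N)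
    (t : BalTensor A M X) :
    k (c.ψAct X (BalTensor.tmul B n t)) = Q.g (BalTensor.tmul B n (extendMap Q k t)) := by
  induction t using BalTensor.induction_on with
  | zero => simp
  | tmul m x => exact (map_smul k _ _).trans (Q.g_f n m (k x)).symm
  | add s t hs ht => simp only [BalTensor.tmul_add, map_add, hs, ht]

/-- Morphisms out of `(X, M ⊗_A X, 1, ψ ⊗ X)` are morphisms out of `X`. -/
def tensorHomEquiv (X : ModuleCat.{u} A) (Q : c.Quad) :
    (tensor c X ⟶ Q) ≃ (X ⟶ (functorX c).obj Q) where
  toFun h := ModuleCat.ofHom h.α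
  invFun k :=
    { α := k.hom
      β := extendMap Q k.hom
      comm_f := fun _ _ => rfl
      comm_g := fun n t => map_ψAct Q k.hom n t }
  left_inv h := by
    refine Hom.ext rfl (BalTensor.linearMap_ext fun m x => (h.comm_f m x).symm)
  right_inv _ := rfl

/-- The functor `X ↦ (X, M ⊗_A X, 1, ψ ⊗ X)`. -/
def functorT : ModuleCat.{u} A ⥤ c.Quad :=
  Adjunction.leftAdjointOfEquiv (G := functorX c) (tensorHomEquiv c) fun _ _ _ _ _ => rfl

/-- `X ↦ (X, M ⊗_A X, 1, ψ ⊗ X)` is left adjoint to `(X, Y, f, g) ↦ X`. -/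
def adjTX : functorT c ⊣ functorX c :=
  Adjunction.adjunctionOfEquivLeft (tensorHomEquiv c) _

/-- The quadruple `(X, Hom_A(N, X), f, g)` with `g` the evaluation. -/
def hom (X : ModuleCat.{u} A) : c.Quad where
  X := X
  Y := ModuleCat.of B (LeftHom A B N X)
  f := c.ψHom X
  g := evalHom A B N X
  g_f _ _ _ := rfl
  f_g m n h := c.ψHom_tmul_eval X m n h

variable {c} in
/-- The `B`-linear map `y ↦ (n ↦ k (g(n ⊗ y)))`. -/
def coextendMap {X : Type*} [AddCommGroup X] [Module A X] (Q : c.Quad) (k : Q.X →ₗ[A] X) :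
    Q.Y →ₗ[B] LeftHom A B N X where
  toFun y := (k ∘ₗ adjointMap Q.g y : N →ₗ[A] X)
  map_add' y y' := LeftHom.ext fun n =>
    (congrArg (fun t => k (Q.g t)) (BalTensor.tmul_add B n y y')).trans (by
      rw [map_add, map_add]; rfl)
  map_smul' b y := LeftHom.ext fun n =>
    congrArg (fun t => k (Q.g t)) (BalTensor.smul_tmul B n b y).symm

variable {c} in
-- Since `g` of the target is evaluation, compatibility with `g` determines the second component
-- from the first.
theorem hom_ext_of_target_hom {Q : c.Quad} {X : ModuleCat.{u} A} {h k : Q ⟶ hom c X}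
    (H : ∀ x, h.α x = k.α x) : h = k := by
  refine hom_ext H fun y => ?_
  exact LeftHom.ext (B := B) (h := h.β y) (k := k.β y) fun n =>
    (h.comm_g n y).symm.trans ((H _).trans (k.comm_g n y))

/-- Morphisms into `(X, Hom_A(N, X), f, g)` are morphisms into `X`. -/
def homHomEquiv (Q : c.Quad) (X : ModuleCat.{u} A) :
    ((functorX c).obj Q ⟶ X) ≃ (Q ⟶ hom c X) where
  toFun k :=
    { α := k.hom
      β := coextendMap Q k.hom
      comm_f := fun m x => LeftHom.ext (B := B) fun n =>
        (congrArg k.hom (Q.g_f n m x)).trans (map_smul k.hom _ _)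
      comm_g := fun _ _ => rfl }
  invFun h := ModuleCat.ofHom h.α
  left_inv _ := rfl
  right_inv _ := hom_ext_of_target_hom fun _ => rfl

/-- The functor `X ↦ (X, Hom_A(N, X), f, g)`. -/
def functorH : ModuleCat.{u} A ⥤ c.Quad :=
  Adjunction.rightAdjointOfEquiv (F := functorX c) (homHomEquiv c)
    fun _ _ _ _ _ => hom_ext_of_target_hom fun _ => rfl

/-- `X ↦ (X, Hom_A(N, X), f, g)` is right adjoint to `(X, Y, f, g) ↦ X`. -/
def adjXH : functorX c ⊣ functorH c :=
  Adjunction.adjunctionOfEquivRight (homHomEquiv c) _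

end Quad

end MoritaContext

/-! ### Modules over a quotient ring -/

section QuotientTensor

variable {S : Type u} [Ring S] (I : Ideal S) [I.IsTwoSided]

theorem quotient_op_smul (b : S) (t : S ⧸ I) : op b • t = t * Ideal.Quotient.mk I b := rfl

/-- `S`-linear maps `W → U` into an `S / I`-module are `S / I`-linear maps `S / I ⊗_S W → U`. -/
def quotientTensorLift {W : Type u} [AddCommGroup W] [Module S W] {U : Type u} [AddCommGroup U]
    [Module (S ⧸ I) U] (k : W →+ U) (hk : ∀ (b : S) w, k (b • w) = Ideal.Quotient.mk I b • k w) :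
    BalTensor S (S ⧸ I) W →ₗ[S ⧸ I] U :=
  BalTensor.liftLinear (fun t w => t • k w) (fun t t' w => add_smul t t' (k w))
    (fun t w w' => by rw [map_add, smul_add])
    (fun t b w => by rw [hk, quotient_op_smul, mul_smul]) (fun s t w => mul_smul s t (k w))

theorem mk_smul_one_tmul {W : Type u} [AddCommGroup W] [Module S W] (b : S) (w : W) :
    Ideal.Quotient.mk I b • BalTensor.tmul S (1 : S ⧸ I) w =
      BalTensor.tmul S (1 : S ⧸ I) (b • w) := by
  rw [BalTensor.smul_tmul_left, ← BalTensor.smul_tmul, quotient_op_smul, smul_eq_mul, mul_one,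
    one_mul]

/-- If `I W = 0` then `W → S / I ⊗_S W` is bijective. -/
theorem one_tmul_bijective {W : Type u} [AddCommGroup W] [Module S W]
    (hW : ∀ b ∈ I, ∀ w : W, b • w = 0) :
    Function.Bijective (fun w : W => BalTensor.tmul S (1 : S ⧸ I) w) := by
  have hW' : Module.IsTorsionBySet S W I := fun w b => hW b b.2 w
  let _ : Module (S ⧸ I) W := hW'.module
  let k : BalTensor S (S ⧸ I) W →ₗ[S ⧸ I] W :=
    quotientTensorLift I (AddMonoidHom.id W) fun b w => (hW'.mk_smul b w).symm
  have hk (w : W) : k (BalTensor.tmul S (1 : S ⧸ I) w) = w := one_smul (S ⧸ I) w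
  refine ⟨Function.LeftInverse.injective hk, fun t => ?_⟩
  induction t using BalTensor.induction_on with
  | zero => exact ⟨0, BalTensor.tmul_zero S _⟩
  | tmul t w =>
    obtain ⟨b, rfl⟩ := Ideal.Quotient.mk_surjective t
    refine ⟨b • w, ?_⟩
    dsimp only
    rw [← mk_smul_one_tmul, BalTensor.smul_tmul_left, smul_eq_mul, mul_one]
  | add s t hs ht =>
    obtain ⟨x, rfl⟩ := hs
    obtain ⟨y, rfl⟩ := ht
    exact ⟨x + y, BalTensor.tmul_add S _ _ _⟩

end QuotientTensor

/-! ### The adjoints of the inclusion of `B/Im φ`-modules. -/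

namespace MoritaContext

variable {A B M N : Type u} [Ring A] [Ring B] [AddCommGroup M] [AddCommGroup N]
  [Module B M] [Module Aᵐᵒᵖ M] [SMulCommClass B Aᵐᵒᵖ M]
  [Module A N] [Module Bᵐᵒᵖ N] [SMulCommClass A Bᵐᵒᵖ N]

namespace Quad

variable (c : MoritaContext A B M N)

variable {c} in
-- On generators `φ(m ⊗ n) y = f(m ⊗ g(n ⊗ y))`. Hence `Ker g̃` is already a `B/Im φ`-module, and so
-- is `Y` when `X = 0`.
theorem φ_smul_eq_zero (Q : c.Quad) {y : Q.Y} (hy : ∀ n, Q.g (BalTensor.tmul B n y) = 0)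
    {b : B} (hb : b ∈ c.imφ) : b • y = 0 := by
  obtain ⟨t, rfl⟩ := hb
  induction t using BalTensor.induction_on with
  | zero => rw [map_zero, zero_smul]
  | tmul m n => rw [← Q.f_g, hy, BalTensor.tmul_zero, map_zero]
  | add s t hs ht => rw [map_add, add_smul, hs, ht, add_zero]

/-- The quadruple `(0, U, 0, 0)` of a `B / Im φ`-module `U`. -/
def inflate (U : ModuleCat.{u} (B ⧸ c.imφ)) : c.Quad where
  X := ModuleCat.of A PUnit
  Y := (ModuleCat.restrictScalars (Ideal.Quotient.mk c.imφ)).obj U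
  f := 0
  g := 0
  g_f _ _ _ := rfl
  f_g m n y := by
    change (0 : U) = Ideal.Quotient.mk c.imφ (c.φ (BalTensor.tmul A m n)) • (y : U)
    rw [Ideal.Quotient.eq_zero_iff_mem.2 (show _ ∈ c.imφ from ⟨_, rfl⟩)]
    exact (zero_smul (B ⧸ c.imφ) (y : U)).symm

/-- The functor `U ↦ (0, U, 0, 0)`. -/
def functorZ : ModuleCat.{u} (B ⧸ c.imφ) ⥤ c.Quad where
  obj := inflate c
  map k := ⟨0, ((ModuleCat.restrictScalars (Ideal.Quotient.mk c.imφ)).map k).hom,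
    fun _ _ => map_zero _, fun _ _ => rfl⟩

instance : (functorZ c).Faithful where
  map_injective {U V h k} hhk := by
    ext u
    exact LinearMap.congr_fun (congrArg Hom.β hhk) u

instance : (functorZ c).Full where
  map_surjective {U V} h := by
    refine ⟨ModuleCat.ofHom
      { toFun := fun u : U => (h.β u : V)
        map_add' := fun u v => map_add h.β u v
        map_smul' := fun s u => ?_ }, rfl⟩
    obtain ⟨b, rfl⟩ := Ideal.Quotient.mk_surjective s
    exact h.β.map_smul b u

variable {c} in
/-- The map `Coker f → U` of a morphism `(X, Y, f, g) ⟶ (0, U, 0, 0)`. -/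
def cokerLift (Q : c.Quad) (U : ModuleCat.{u} (B ⧸ c.imφ)) (h : Q ⟶ (functorZ c).obj U) :
    (Q.Y ⧸ LinearMap.range Q.f) →ₗ[B] (inflate c U).Y :=
  (LinearMap.range Q.f).liftQ h.β (by
    rintro _ ⟨t, rfl⟩
    induction t using BalTensor.induction_on with
    | zero => simp
    | tmul m x => exact h.comm_f m x
    | add s t hs ht => rw [map_add]; exact add_mem hs ht)

/-- Morphisms `(X, Y, f, g) ⟶ (0, U, 0, 0)` are maps out of `B / Im φ ⊗_B Coker f`. -/
def cokerHomEquiv (Q : c.Quad) (U : ModuleCat.{u} (B ⧸ c.imφ)) :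
    (quotientTensor c.imφ (Q.Y ⧸ LinearMap.range Q.f) ⟶ U) ≃ (Q ⟶ (functorZ c).obj U) where
  toFun k :=
    { α := 0
      β :=
        { toFun := fun y => k.hom (BalTensor.tmul B (1 : B ⧸ c.imφ)
            ((LinearMap.range Q.f).mkQ y))
          map_add' := fun y y' => by
            rw [map_add]
            exact (congrArg k.hom (BalTensor.tmul_add B _ _ _)).trans (map_add k.hom _ _)
          map_smul' := fun b y => by
            rw [map_smul]
            exact (congrArg k.hom (mk_smul_one_tmul c.imφ b _).symm).trans (map_smul k.hom _ _) }
      comm_f := fun m x => by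
        refine (congrArg (fun w => k.hom (BalTensor.tmul B (1 : B ⧸ c.imφ) w))
          ((Submodule.Quotient.mk_eq_zero _).2 ⟨_, rfl⟩)).trans ?_
        exact (congrArg k.hom (BalTensor.tmul_zero B _)).trans (map_zero k.hom)
      comm_g := fun n y => rfl }
  invFun h := ModuleCat.ofHom (quotientTensorLift (U := U) c.imφ
    (cokerLift Q U h).toAddMonoidHom (cokerLift Q U h).map_smul)
  left_inv k := by
    refine ModuleCat.hom_ext (BalTensor.linearMap_ext fun t w => ?_)
    obtain ⟨y, rfl⟩ := (LinearMap.range Q.f).mkQ_surjective w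
    change t • k.hom (BalTensor.tmul B (1 : B ⧸ c.imφ) _) = k.hom (BalTensor.tmul B t _)
    exact (map_smul k.hom t _).symm.trans <| congrArg k.hom ((BalTensor.smul_tmul_left _ _ _).trans
      (congrArg (BalTensor.tmul B · _) (mul_one t)))
  right_inv h := hom_ext (fun x => rfl) fun y =>
    one_smul (B ⧸ c.imφ) (show U from h.β y)

/-- The functor `(X, Y, f, g) ↦ B / Im φ ⊗_B Coker f`. -/
def functorF : c.Quad ⥤ ModuleCat.{u} (B ⧸ c.imφ) :=
  Adjunction.leftAdjointOfEquiv (G := functorZ c) (cokerHomEquiv c) fun _ _ _ _ _ =>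
    hom_ext (fun _ => rfl) fun _ => rfl

/-- `(X, Y, f, g) ↦ B / Im φ ⊗_B Coker f` is left adjoint to `U ↦ (0, U, 0, 0)`. -/
def adjFZ : functorF c ⊣ functorZ c :=
  Adjunction.adjunctionOfEquivLeft (cokerHomEquiv c) _

variable {c} in
/-- `Ker g̃` is a `B / Im φ`-module. -/
def adjointKerEquiv (Q : c.Quad) :
    adjointKer Q.g ≃ BalTensor B (B ⧸ c.imφ) (adjointKer Q.g) :=
  .ofBijective _ (one_tmul_bijective c.imφ fun _ hb y => Subtype.ext
    (φ_smul_eq_zero Q (fun n => LinearMap.congr_fun y.2 n) hb))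

variable {c} in
theorem adjointKerEquiv_add (Q : c.Quad) (y y' : adjointKer Q.g) :
    adjointKerEquiv Q (y + y') = adjointKerEquiv Q y + adjointKerEquiv Q y' :=
  BalTensor.tmul_add B _ _ _

variable {c} in
theorem adjointKerEquiv_smul (Q : c.Quad) (b : B) (y : adjointKer Q.g) :
    adjointKerEquiv Q (b • y) = Ideal.Quotient.mk c.imφ b • adjointKerEquiv Q y :=
  (mk_smul_one_tmul c.imφ b y).symm

variable {c} in
theorem adjointKerEquiv_symm_add (Q : c.Quad) (s t : BalTensor B (B ⧸ c.imφ) (adjointKer Q.g)) :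
    (adjointKerEquiv Q).symm (s + t) =
      (adjointKerEquiv Q).symm s + (adjointKerEquiv Q).symm t := by
  rw [Equiv.symm_apply_eq, adjointKerEquiv_add, Equiv.apply_symm_apply, Equiv.apply_symm_apply]

variable {c} in
theorem adjointKerEquiv_symm_smul (Q : c.Quad) (b : B)
    (t : BalTensor B (B ⧸ c.imφ) (adjointKer Q.g)) :
    (adjointKerEquiv Q).symm (Ideal.Quotient.mk c.imφ b • t) = b • (adjointKerEquiv Q).symm t := by
  rw [Equiv.symm_apply_eq, adjointKerEquiv_smul, Equiv.apply_symm_apply]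

/-- Morphisms `(0, U, 0, 0) ⟶ (X, Y, f, g)` are maps into `B / Im φ ⊗_B Ker g̃`. -/
def kerHomEquiv (U : ModuleCat.{u} (B ⧸ c.imφ)) (Q : c.Quad) :
    ((functorZ c).obj U ⟶ Q) ≃ (U ⟶ quotientTensor c.imφ (adjointKer Q.g)) where
  toFun h := ModuleCat.ofHom
    { toFun := fun u => adjointKerEquiv Q ⟨h.β u, LinearMap.ext fun n => (h.comm_g n u).symm.trans
        (map_zero h.α)⟩
      map_add' := fun u v => by
        rw [← adjointKerEquiv_add]
        exact congrArg (adjointKerEquiv Q) (Subtype.ext (map_add h.β u v))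
      map_smul' := fun s u => by
        obtain ⟨b, rfl⟩ := Ideal.Quotient.mk_surjective s
        refine Eq.trans ?_ (adjointKerEquiv_smul Q b _)
        exact congrArg (adjointKerEquiv Q) (Subtype.ext (h.β.map_smul b u)) }
  invFun k :=
    { α := 0
      β :=
        { toFun := fun u => ((adjointKerEquiv Q).symm (k.hom u)).1
          map_add' := fun u v => congrArg Subtype.val
            ((congrArg (adjointKerEquiv Q).symm (map_add k.hom (u : U) (v : U))).trans
              (adjointKerEquiv_symm_add Q _ _))
          map_smul' := fun b u => congrArg Subtype.val
            ((congrArg (adjointKerEquiv Q).symm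
              (k.hom.map_smul (Ideal.Quotient.mk c.imφ b) u)).trans
              (adjointKerEquiv_symm_smul Q _ _)) }
      comm_f := fun m x => by
        refine (congrArg (fun w => ((adjointKerEquiv Q).symm w).1) (map_zero k.hom)).trans ?_
        have : (adjointKerEquiv Q).symm 0 = 0 :=
          (Equiv.symm_apply_eq _).2 (BalTensor.tmul_zero B _).symm
        refine (congrArg Subtype.val this).trans ?_
        exact ((congrArg Q.f (BalTensor.tmul_zero A m)).trans (map_zero Q.f)).symm
      comm_g := fun n u =>
        (LinearMap.congr_fun ((adjointKerEquiv Q).symm (k.hom u)).2 n).symm }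
  left_inv h := hom_ext (fun x => (map_zero h.α).symm) fun u =>
    congrArg Subtype.val ((adjointKerEquiv Q).symm_apply_apply _)
  right_inv k := by
    ext u
    exact (adjointKerEquiv Q).apply_symm_apply _

/-- The functor `(X, Y, f, g) ↦ B / Im φ ⊗_B Ker g̃`. -/
def functorG : c.Quad ⥤ ModuleCat.{u} (B ⧸ c.imφ) :=
  Adjunction.rightAdjointOfEquiv (F := functorZ c) (kerHomEquiv c) fun _ _ _ _ _ => rfl

/-- `(X, Y, f, g) ↦ B / Im φ ⊗_B Ker g̃` is right adjoint to `U ↦ (0, U, 0, 0)`. -/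
def adjZG : functorZ c ⊣ functorG c :=
  Adjunction.adjunctionOfEquivRight (kerHomEquiv c) _

end Quad

end MoritaContext

/-- Transport of a recollement along an equivalence. -/
def Recollement.ofEquivalence {A : Type u₁} [Category.{v₁} A] {B : Type u₂} [Category.{v₂} B]
    {D : Type u₃} [Category.{v₃} D] {E : Type u₄} [Category.{v₄} E] (R : Recollement A B D)
    (ε : D ≌ E) : Recollement A B E where
  T := R.T ⋙ ε.functor
  e := ε.inverse ⋙ R.e
  H := R.H ⋙ ε.functor
  F := ε.inverse ⋙ R.F
  Z := R.Z ⋙ ε.functor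
  G := ε.inverse ⋙ R.G
  adjTe := R.adjTe.comp ε.toAdjunction
  adjeH := ε.symm.toAdjunction.comp R.adjeH
  adjFZ := ε.symm.toAdjunction.comp R.adjFZ
  adjZG := R.adjZG.comp ε.toAdjunction
  full_T := have := R.full_T; inferInstance
  faithful_T := have := R.faithful_T; inferInstance
  full_Z := have := R.full_Z; inferInstance
  faithful_Z := have := R.faithful_Z; inferInstance
  isZero_e_Z U := (R.isZero_e_Z U).of_iso (R.e.mapIso (ε.unitIso.app (R.Z.obj U)).symm)
  essImage_Z W hW := by
    obtain ⟨U, ⟨i⟩⟩ := R.essImage_Z _ hW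
    exact ⟨U, ⟨ε.functor.mapIso i ≪≫ ε.counitIso.app W⟩⟩

/-! ### Monic counits and epic units under an equivalence. -/

namespace Recollement

variable {A : Type u₁} [Category.{v₁} A] {B : Type u₂} [Category.{v₂} B] {D : Type u₃}
  [Category.{v₃} D] {E : Type u₄} [Category.{v₄} E] (R : Recollement A B D) (ε : D ≌ E) (Z : E)

theorem mono_ofEquivalence_counit_iff :
    Mono ((R.ofEquivalence ε).adjTe.counit.app Z) ↔
      Mono (R.adjTe.counit.app (ε.inverse.obj Z)) := by
  change Mono ((R.adjTe.comp ε.toAdjunction).counit.app Z) ↔ _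
  have h : (R.adjTe.comp ε.toAdjunction).counit.app Z =
      ε.functor.map (R.adjTe.counit.app (ε.inverse.obj Z)) ≫ ε.counitIso.hom.app Z :=
    Adjunction.comp_counit_app _ _ _
  rw [h, ← Functor.mono_map_iff_mono ε.functor]
  exact ⟨fun _ => mono_of_mono _ (ε.counitIso.hom.app Z), fun _ => mono_comp _ _⟩

theorem epi_ofEquivalence_unit_iff :
    Epi ((R.ofEquivalence ε).adjeH.unit.app Z) ↔ Epi (R.adjeH.unit.app (ε.inverse.obj Z)) := by
  change Epi ((ε.symm.toAdjunction.comp R.adjeH).unit.app Z) ↔ _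
  have h : (ε.symm.toAdjunction.comp R.adjeH).unit.app Z =
      ε.counitIso.inv.app Z ≫ ε.functor.map (R.adjeH.unit.app (ε.inverse.obj Z)) :=
    Adjunction.comp_unit_app _ _ _
  rw [h, ← Functor.epi_map_iff_epi ε.functor]
  exact ⟨fun _ => epi_of_epi (ε.counitIso.inv.app Z) _, fun _ => epi_comp _ _⟩

end Recollement

/-! ### Exchange of `A` and `B`, and the recollement of quadruples. -/

namespace MoritaContext

variable {A B M N : Type u} [Ring A] [Ring B] [AddCommGroup M] [AddCommGroup N]
  [Module B M] [Module Aᵐᵒᵖ M] [SMulCommClass B Aᵐᵒᵖ M]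
  [Module A N] [Module Bᵐᵒᵖ N] [SMulCommClass A Bᵐᵒᵖ N]

/-- The Morita context with the roles of `A` and `B` exchanged. -/
def swap (c : MoritaContext A B M N) : MoritaContext B A N M where
  φ := c.ψ
  ψ := c.φ
  φ_right := c.ψ_right
  ψ_right := c.φ_right
  assoc_M := c.assoc_N
  assoc_N := c.assoc_M

namespace Quad

variable {c : MoritaContext A B M N}

/-- A quadruple over the exchanged Morita context. -/
def swap (Q : c.swap.Quad) : c.Quad := ⟨Q.Y, Q.X, Q.g, Q.f, Q.f_g, Q.g_f⟩

variable (c) in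
/-- Quadruples over a Morita context and over the exchanged one are the same. -/
def swapEquivalence : c.swap.Quad ≌ c.Quad where
  functor :=
    { obj := swap
      map := fun h => ⟨h.β, h.α, h.comm_g, h.comm_f⟩ }
  inverse :=
    { obj := fun Q => swap (c := c.swap) Q
      map := fun h => ⟨h.β, h.α, h.comm_g, h.comm_f⟩ }
  unitIso := Iso.refl _
  counitIso := Iso.refl _
  functor_unitIso_comp _ := rfl

/-! ### Monomorphisms and epimorphisms -/

/-- The equivalence with `Λ`-modules turns monomorphisms into injective maps of columns. -/
theorem mono_iff {P Q : c.Quad} (h : P ⟶ Q) :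
    Mono h ↔ Function.Injective h.α ∧ Function.Injective h.β := by
  refine ⟨fun _ => ?_, fun H => mono_of_injective h H.1 H.2⟩
  have H : Function.Injective h.toLinearMap :=
    (ModuleCat.mono_iff_injective ((toLam c).map h)).1 inferInstance
  refine ⟨fun x x' hx => ?_, fun y y' hy => ?_⟩
  · exact congrArg Col.x (@H ⟨x, 0⟩ ⟨x', 0⟩ (Col.ext hx rfl))
  · exact congrArg Col.y (@H ⟨0, y⟩ ⟨0, y'⟩ (Col.ext rfl hy))

theorem epi_iff {P Q : c.Quad} (h : P ⟶ Q) :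
    Epi h ↔ Function.Surjective h.α ∧ Function.Surjective h.β := by
  refine ⟨fun _ => ?_, fun H => epi_of_surjective h H.1 H.2⟩
  have H : Function.Surjective h.toLinearMap :=
    (ModuleCat.epi_iff_surjective ((toLam c).map h)).1 inferInstance
  refine ⟨fun x => ?_, fun y => ?_⟩
  · obtain ⟨u, hu⟩ := H ⟨x, 0⟩
    exact ⟨u.x, congrArg Col.x hu⟩
  · obtain ⟨u, hu⟩ := H ⟨0, y⟩
    exact ⟨u.y, congrArg Col.y hu⟩

theorem mono_adjTX_counit_iff (Q : c.Quad) :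
    Mono ((adjTX c).counit.app Q) ↔ Function.Injective Q.f := by
  have h : ((adjTX c).counit.app Q).β = Q.f := BalTensor.linearMap_ext fun _ _ => rfl
  rw [mono_iff, h]
  exact and_iff_right fun _ _ h => h

theorem epi_adjXH_unit_iff (Q : c.Quad) :
    Epi ((adjXH c).unit.app Q) ↔ Function.Surjective (adjointMap Q.g) := by
  rw [epi_iff]
  exact and_iff_right fun x => ⟨x, rfl⟩

variable (c) in
/-- The recollement of the category of quadruples by `A`-modules and `B / Im φ`-modules. -/
def recollement : Recollement (ModuleCat.{u} A) (ModuleCat.{u} (B ⧸ c.imφ)) c.Quad where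
  T := functorT c
  e := functorX c
  H := functorH c
  F := functorF c
  Z := functorZ c
  G := functorG c
  adjTe := adjTX c
  adjeH := adjXH c
  adjFZ := adjFZ c
  adjZG := adjZG c
  full_T := by
    have (X : ModuleCat.{u} A) : IsIso ((adjTX c).unit.app X) := inferInstanceAs (IsIso (𝟙 X))
    have := NatIso.isIso_of_isIso_app (adjTX c).unit
    exact (adjTX c).fullyFaithfulLOfIsIsoUnit.full
  faithful_T := by
    have (X : ModuleCat.{u} A) : IsIso ((adjTX c).unit.app X) := inferInstanceAs (IsIso (𝟙 X))
    have := NatIso.isIso_of_isIso_app (adjTX c).unit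
    exact (adjTX c).fullyFaithfulLOfIsIsoUnit.faithful
  full_Z := inferInstance
  faithful_Z := inferInstance
  isZero_e_Z U := ModuleCat.isZero_of_subsingleton (ModuleCat.of A PUnit)
  essImage_Z Q hQ := by
    have hX : Subsingleton Q.X := ModuleCat.subsingleton_of_isZero hQ
    -- With `X = 0` the ideal `Im φ` annihilates `Y`, which thereby becomes a `B/Im φ`-module.
    have hI (b : B) (hb : b ∈ c.imφ) (y : Q.Y) : b • y = 0 :=
      φ_smul_eq_zero Q (fun n => Subsingleton.elim _ _) hb
    have hI' : Module.IsTorsionBySet B Q.Y c.imφ := fun y b => hI b b.2 y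
    let _ : Module (B ⧸ c.imφ) Q.Y := hI'.module
    refine ⟨ModuleCat.of (B ⧸ c.imφ) Q.Y, ⟨isoMk
      { toFun := fun _ => 0
        invFun := fun _ => PUnit.unit
        map_add' := fun _ _ => (add_zero _).symm
        map_smul' := fun _ _ => (smul_zero _).symm
        left_inv := fun _ => rfl
        right_inv := fun _ => Subsingleton.elim _ _ }
      { toFun := fun y => y
        invFun := fun y => y
        map_add' := fun _ _ => rfl
        map_smul' := fun b y => hI'.mk_smul b y
        left_inv := fun _ => rfl
        right_inv := fun _ => rfl } (fun m x => ?_) (fun n y => Subsingleton.elim _ _)⟩⟩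
    exact ((congrArg Q.f (BalTensor.tmul_zero A m)).trans (map_zero Q.f)).symm

/-! ### Projective quadruples -/

/-- The quadruple `(Hom_B(M, J), J, f, g)` with `f` the evaluation. -/
def homY (c : MoritaContext A B M N) (J : ModuleCat.{u} B) : c.Quad := swap (hom c.swap J)

/-- A map `N → Hom_B(M, J)` amounts to a map `M ⊗_A N → J`. As `φ` is injective and `J` is
injective, this extends along `φ` to `B → J`, which is determined by the image of `1`. -/
theorem epi_adjXH_unit_homY (hφ : Function.Injective c.φ) (J : ModuleCat.{u} B) [Injective J] :
    Epi ((adjXH c).unit.app (homY c J)) := by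
  rw [epi_adjXH_unit_iff]
  intro (h : N →ₗ[A] LeftHom B A M J)
  let k : BalTensor A M N →ₗ[B] J :=
    BalTensor.liftLinear (fun m n => h n m)
      (fun m m' n => map_add (h n) m m')
      (fun m n n' => congrArg (fun t : LeftHom B A M J => t m) (map_add h n n'))
      (fun m a n => congrArg (fun t : LeftHom B A M J => t m) (map_smul h a n).symm)
      (fun b m n => map_smul (h n) b m)
  have : Mono (ModuleCat.ofHom c.φ) := (ModuleCat.mono_iff_injective _).2 hφ
  let l : ModuleCat.of B B ⟶ J := Injective.factorThru (ModuleCat.ofHom k) (ModuleCat.ofHom c.φ)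
  have hl (t : BalTensor A M N) : l.hom (c.φ t) = k t :=
    LinearMap.congr_fun (congrArg ModuleCat.Hom.hom
      (Injective.comp_factorThru (ModuleCat.ofHom k) (ModuleCat.ofHom c.φ))) t
  refine ⟨l.hom (1 : B), LinearMap.ext fun n => LeftHom.ext (B := A) fun m => ?_⟩
  change c.φ (BalTensor.tmul A m n) • l.hom (1 : B) = k (BalTensor.tmul A m n)
  rw [← hl]
  exact (map_smul l.hom _ _).symm.trans (congrArg l.hom (mul_one _))

/-- Embed `M ⊗_A X` in an injective `J`. The transpose `X → Hom_B(M, J)` gives a morphism from `Q`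
to `H e` of `homY c J`; by projectivity it lifts along the epic unit to `homY c J`. The second
component of the lift, composed with `f`, is the embedding. -/
theorem injective_f_of_projective (hφ : Function.Injective c.φ) (Q : c.Quad) [Projective Q] :
    Function.Injective Q.f := by
  let J : ModuleCat.{u} B := Injective.under (ModuleCat.of B (BalTensor A M Q.X))
  let j : ModuleCat.of B (BalTensor A M Q.X) ⟶ J := Injective.ι _
  have hj : Function.Injective j.hom := (ModuleCat.mono_iff_injective j).1 inferInstance
  let k : Q.X →ₗ[A] LeftHom B A M J :=
    { toFun := fun x =>
        { toFun := fun m => j.hom (BalTensor.tmul A m x)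
          map_add' := fun m m' =>
            (congrArg j.hom (BalTensor.add_tmul A m m' x)).trans (map_add j.hom _ _)
          map_smul' := fun b m =>
            (congrArg j.hom (BalTensor.smul_tmul_left b m x).symm).trans (map_smul j.hom _ _) }
      map_add' := fun x x' => LeftHom.ext (B := A) fun m =>
        (congrArg j.hom (BalTensor.tmul_add A m x x')).trans (map_add j.hom _ _)
      map_smul' := fun a x => LeftHom.ext (B := A) fun m =>
        congrArg j.hom (BalTensor.smul_tmul A m a x).symm }
  have := epi_adjXH_unit_homY hφ J
  let K : Q ⟶ (functorH c).obj ((functorX c).obj (homY c J)) :=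
    homHomEquiv c Q (homY c J).X (ModuleCat.ofHom k)
  let s : Q ⟶ homY c J := Projective.factorThru K ((adjXH c).unit.app (homY c J))
  have hs : s ≫ (adjXH c).unit.app (homY c J) = K := Projective.factorThru_comp _ _
  have hα (x : Q.X) : s.α x = k x := LinearMap.congr_fun (congrArg Hom.α hs) x
  have hβ (t : BalTensor A M Q.X) : s.β (Q.f t) = j.hom t := by
    refine LinearMap.congr_fun (f := s.β ∘ₗ Q.f) (g := j.hom)
      (BalTensor.linearMap_ext fun m x => ?_) t
    refine (s.comm_f m x).trans ?_
    exact congrArg (fun h : LeftHom B A M J => h m) (hα x)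
  intro t t' h
  exact hj ((hβ t).symm.trans ((congrArg s.β h).trans (hβ t')))

/-! ### Exactness of the adjoints of `(X, Y, f, g) ↦ X` -/

theorem mono_functorT_map {U : ObjectProperty (ModuleCat.{u} A)} (hU : TorOneVanishes A M U)
    (S : ShortComplex (ModuleCat.{u} A)) (hS : S.ShortExact) (h : U S.X₃) :
    Mono ((functorT c).map S.f) := by
  have h₁ : Function.Injective ((functorT c).map S.f).α :=
    (ModuleCat.mono_iff_injective S.f).1 hS.mono_f
  refine mono_of_injective _ h₁ ?_
  have := map_injective_of_torOne M hS (hU _ h)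
  have h₂ : ((functorT c).map S.f).β.toAddMonoidHom =
      BalTensor.map (LinearMap.id : M →ₗ[Aᵐᵒᵖ] M) S.f.hom := BalTensor.addHom_ext fun _ _ => rfl
  rw [← h₂] at this
  exact this

/-- On second components the map is `Hom_A(N, S.g)`, and `Ext¹_A(N, S.X₁) = 0` provides the lifts.
-/
theorem epi_functorH_map {V : ObjectProperty (ModuleCat.{u} A)} (hV : ExtOneVanishes A N V)
    (S : ShortComplex (ModuleCat.{u} A)) (hS : S.ShortExact) (h : V S.X₁) :
    Epi ((functorH c).map S.g) := by
  have h₁ : Function.Surjective ((functorH c).map S.g).α :=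
    (ModuleCat.epi_iff_surjective S.g).1 hS.epi_g
  refine epi_of_surjective _ h₁ fun k => ?_
  obtain ⟨l, hl⟩ : ∃ l : ModuleCat.of A N ⟶ S.X₂,
      l ≫ S.g = ModuleCat.ofHom (show N →ₗ[A] S.X₃ from k) :=
    Cotorsion.Orth.lift hS (hV _ h) _
  exact ⟨l.hom, congrArg ModuleCat.Hom.hom hl⟩

end Quad

end MoritaContext

/-! ### The glued classes of `Λ`-modules. -/

namespace MoritaContext

variable {A B M N : Type u} [Ring A] [Ring B] [AddCommGroup M] [AddCommGroup N]
  [Module B M] [Module Aᵐᵒᵖ M] [SMulCommClass B Aᵐᵒᵖ M]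
  [Module A N] [Module Bᵐᵒᵖ N] [SMulCommClass A Bᵐᵒᵖ N]

namespace Quad

variable {c : MoritaContext A B M N} {E : Type u₁} [Category.{v₁} E] (ε : c.Quad ≌ E)

theorem leftClass_ofEquivalence_iff {U' V' : ObjectProperty (ModuleCat.{u} (B ⧸ c.imφ))}
    {U'' V'' : ObjectProperty (ModuleCat.{u} A)} (h' : IsCotorsionPair.{u} U' V')
    (h'' : IsCotorsionPair.{u} U'' V'') (Z : E) :
    ((recollement c).ofEquivalence ε).leftClass U' U'' Z ↔ ∃ Q : c.Quad,
      Nonempty (Z ≅ ε.functor.obj Q) ∧ U' (quotientTensor c.imφ (Q.Y ⧸ LinearMap.range Q.f)) ∧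
        U'' Q.X ∧ Function.Injective Q.f := by
  have key : Mono (((recollement c).ofEquivalence ε).adjTe.counit.app Z) ↔
      Mono ((adjTX c).counit.app (ε.inverse.obj Z)) :=
    (recollement c).mono_ofEquivalence_counit_iff ε Z
  constructor
  · rintro ⟨h₁, h₂, h₃⟩
    exact ⟨ε.inverse.obj Z, ⟨(ε.counitIso.app Z).symm⟩, h₁, h₂,
      (mono_adjTX_counit_iff _).1 (key.1 h₃)⟩
  · rintro ⟨Q, ⟨i⟩, h₁, h₂, h₃⟩
    -- The witness `Q` need not be `ε.inverse.obj Z`; halves of cotorsion pairs are closed under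
    -- isomorphism, so the conditions transfer along `j`.
    let j : Q ≅ ε.inverse.obj Z := ε.unitIso.app Q ≪≫ ε.inverse.mapIso i.symm
    refine ⟨h'.left_of_iso ((functorF c).mapIso j) h₁, h''.left_of_iso ((functorX c).mapIso j) h₂,
      key.2 ?_⟩
    have := (mono_adjTX_counit_iff Q).2 h₃
    have e : (adjTX c).counit.app (ε.inverse.obj Z) =
        ((functorT c).map ((functorX c).map j.inv) ≫ (adjTX c).counit.app Q) ≫ j.hom :=
      (Iso.comp_inv_eq j).1 ((adjTX c).counit_naturality j.inv).symm
    rw [e]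
    infer_instance

theorem rightClass_ofEquivalence_iff {U' V' : ObjectProperty (ModuleCat.{u} (B ⧸ c.imφ))}
    {U'' V'' : ObjectProperty (ModuleCat.{u} A)} (h' : IsCotorsionPair.{u} U' V')
    (h'' : IsCotorsionPair.{u} U'' V'') (Z : E) :
    ((recollement c).ofEquivalence ε).rightClass V' V'' Z ↔ ∃ Q : c.Quad,
      Nonempty (Z ≅ ε.functor.obj Q) ∧ V' (quotientTensor c.imφ (adjointKer Q.g)) ∧
        V'' Q.X ∧ Function.Surjective (adjointMap Q.g) := by
  have key : Epi (((recollement c).ofEquivalence ε).adjeH.unit.app Z) ↔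
      Epi ((adjXH c).unit.app (ε.inverse.obj Z)) :=
    (recollement c).epi_ofEquivalence_unit_iff ε Z
  constructor
  · rintro ⟨h₁, h₂, h₃⟩
    exact ⟨ε.inverse.obj Z, ⟨(ε.counitIso.app Z).symm⟩, h₁, h₂,
      (epi_adjXH_unit_iff _).1 (key.1 h₃)⟩
  · rintro ⟨Q, ⟨i⟩, h₁, h₂, h₃⟩
    let j : Q ≅ ε.inverse.obj Z := ε.unitIso.app Q ≪≫ ε.inverse.mapIso i.symm
    refine ⟨h'.right_of_iso ((functorG c).mapIso j) h₁,
      h''.right_of_iso ((functorX c).mapIso j) h₂, key.2 ?_⟩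
    have := (epi_adjXH_unit_iff Q).2 h₃
    have e : (adjXH c).unit.app (ε.inverse.obj Z) =
        j.inv ≫ (adjXH c).unit.app Q ≫ (functorH c).map ((functorX c).map j.hom) := by
      rw [Iso.eq_inv_comp]
      exact ((adjXH c).unit_naturality j.hom).symm
    rw [e]
    infer_instance

variable [Abelian E] [HasExt.{w₁} E] [EnoughProjectives E] [EnoughInjectives E]

/-- The target category and the equivalence are left arbitrary, so that one statement covers both
parts: in the second, quadruples over the exchanged context are compared with modules over the
original `Λ`. -/
theorem glued_classes (hφ : Function.Injective c.φ)
    {U' V' : ObjectProperty (ModuleCat.{u} (B ⧸ c.imφ))}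
    {U'' V'' : ObjectProperty (ModuleCat.{u} A)} (h' : IsCotorsionPair.{u} U' V')
    (h'' : IsCotorsionPair.{u} U'' V'') {C D : ObjectProperty E}
    (hC : ∀ Z, C Z ↔ ∃ Q : c.Quad, Nonempty (Z ≅ ε.functor.obj Q) ∧
      U' (quotientTensor c.imφ (Q.Y ⧸ LinearMap.range Q.f)) ∧ U'' Q.X ∧ Function.Injective Q.f)
    (hD : ∀ Z, D Z ↔ ∃ Q : c.Quad, Nonempty (Z ≅ ε.functor.obj Q) ∧
      V' (quotientTensor c.imφ (adjointKer Q.g)) ∧ V'' Q.X ∧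
        Function.Surjective (adjointMap Q.g)) :
    (TorOneVanishes A M U'' → IsCotorsionPair.{w₁} (leftPerp.{w₁} D) D) ∧
    (ExtOneVanishes A N V'' → IsCotorsionPair.{w₁} C (rightPerp.{w₁} C)) ∧
    (TorOneVanishes A M U'' → ExtOneVanishes A N V'' →
      IsCotorsionPair.{w₁} C D ∧
      (Cotorsion.IsComplete U' V' → IsHereditary U' V' →
        Cotorsion.IsComplete U'' V'' → IsHereditary U'' V'' →
        Cotorsion.IsComplete C D ∧ IsHereditary C D)) := by
  let R := (recollement c).ofEquivalence ε
  obtain rfl : R.leftClass U' U'' = C := by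
    ext Z
    rw [hC, leftClass_ofEquivalence_iff ε h' h'']
  obtain rfl : R.rightClass V' V'' = D := by
    ext Z
    rw [hD, rightClass_ofEquivalence_iff ε h' h'']
  have hproj (P : E) (hP : Projective P) : Mono (R.adjTe.counit.app P) := by
    have : Projective (ε.inverse.obj P) := ε.symm.toAdjunction.map_projective P hP
    exact ((recollement c).mono_ofEquivalence_counit_iff ε P).2
      ((mono_adjTX_counit_iff _).2 (injective_f_of_projective hφ (ε.inverse.obj P)))
  have hT (hM : TorOneVanishes A M U'') (S : ShortComplex (ModuleCat.{u} A)) (hS : S.ShortExact)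
      (h : U'' S.X₃) : Mono (R.T.map S.f) :=
    have := mono_functorT_map (c := c) hM S hS h
    inferInstanceAs (Mono (ε.functor.map ((functorT c).map S.f)))
  have hH (hN : ExtOneVanishes A N V'') (S : ShortComplex (ModuleCat.{u} A)) (hS : S.ShortExact)
      (h : V'' S.X₁) : Epi (R.H.map S.g) :=
    have := epi_functorH_map (c := c) hN S hS h
    inferInstanceAs (Epi (ε.functor.map ((functorH c).map S.g)))
  refine ⟨fun hM => R.isCotorsionPair_rightClass hproj h' h'' (hT hM),
    fun hN => R.isCotorsionPair_leftClass hproj h' h'' (hH hN), fun hM hN => ?_⟩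
  have hCD := R.isCotorsionPair_classes hproj h' h'' (hT hM) (hH hN)
  exact ⟨hCD, fun hc' hh' hc'' hh'' =>
    ⟨R.isComplete_classes h' h'' hCD hproj hc' hc'' (hT hM),
      R.isHereditary_classes hh' hh'' (hT hM) (hH hN)⟩⟩

end Quad

end MoritaContext

end

theorem corollary4p6 {A B M N : Type u} [Ring A] [Ring B] [AddCommGroup M] [AddCommGroup N]
    [Module B M] [Module Aᵐᵒᵖ M] [SMulCommClass B Aᵐᵒᵖ M]
    [Module A N] [Module Bᵐᵒᵖ N] [SMulCommClass A Bᵐᵒᵖ N]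
    (c : MoritaContext A B M N) :
    (Function.Injective c.φ →
      ∀ (U' V' : ObjectProperty (ModuleCat.{u} (B ⧸ c.imφ)))
        (U'' V'' : ObjectProperty (ModuleCat.{u} A)),
        Cotorsion.IsCotorsionPair.{u} U' V' → Cotorsion.IsCotorsionPair.{u} U'' V'' →
        (TorOneVanishes A M U'' →
          Cotorsion.IsCotorsionPair.{u}
            (Cotorsion.leftPerp.{u} (c.classN V' V'')) (c.classN V' V'')) ∧
        (ExtOneVanishes A N V'' →
          Cotorsion.IsCotorsionPair.{u}
            (c.classM U' U'') (Cotorsion.rightPerp.{u} (c.classM U' U''))) ∧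
        (TorOneVanishes A M U'' → ExtOneVanishes A N V'' →
          Cotorsion.IsCotorsionPair.{u} (c.classM U' U'') (c.classN V' V'') ∧
          (Cotorsion.IsComplete U' V' → Cotorsion.IsHereditary U' V' →
            Cotorsion.IsComplete U'' V'' → Cotorsion.IsHereditary U'' V'' →
            Cotorsion.IsComplete (c.classM U' U'') (c.classN V' V'') ∧
            Cotorsion.IsHereditary (c.classM U' U'') (c.classN V' V'')))) ∧
    (Function.Injective c.ψ →
      ∀ (C' D' : ObjectProperty (ModuleCat.{u} (A ⧸ c.imψ)))
        (C'' D'' : ObjectProperty (ModuleCat.{u} B)),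
        Cotorsion.IsCotorsionPair.{u} C' D' → Cotorsion.IsCotorsionPair.{u} C'' D'' →
        (TorOneVanishes B N C'' →
          Cotorsion.IsCotorsionPair.{u}
            (Cotorsion.leftPerp.{u} (c.classNsymm D' D'')) (c.classNsymm D' D'')) ∧
        (ExtOneVanishes B M D'' →
          Cotorsion.IsCotorsionPair.{u}
            (c.classMsymm C' C'') (Cotorsion.rightPerp.{u} (c.classMsymm C' C''))) ∧
        (TorOneVanishes B N C'' → ExtOneVanishes B M D'' →
          Cotorsion.IsCotorsionPair.{u} (c.classMsymm C' C'') (c.classNsymm D' D'') ∧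
          (Cotorsion.IsComplete C' D' → Cotorsion.IsHereditary C' D' →
            Cotorsion.IsComplete C'' D'' → Cotorsion.IsHereditary C'' D'' →
            Cotorsion.IsComplete (c.classMsymm C' C'') (c.classNsymm D' D'') ∧
            Cotorsion.IsHereditary (c.classMsymm C' C'') (c.classNsymm D' D'')))) := by

  refine ⟨fun hφ U' V' U'' V'' h' h'' => ?_, fun hψ C' D' C'' D'' h' h'' => ?_⟩
  · exact MoritaContext.Quad.glued_classes (MoritaContext.Quad.toLam c).asEquivalence hφ h' h''
      (fun _ => Iff.rfl) fun _ => Iff.rfl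
  -- Exchanging `A` and `B` turns `ψ` into the new `φ` and `g`, `f̃` into the new `f`, `g̃`; the
  -- classes match by swapping the quadruple.
  · refine MoritaContext.Quad.glued_classes (c := c.swap)
      ((MoritaContext.Quad.swapEquivalence c).trans (MoritaContext.Quad.toLam c).asEquivalence)
      hψ h' h'' (fun _ => ⟨?_, ?_⟩) fun _ => ⟨?_, ?_⟩
    · exact fun ⟨Q, hQ⟩ => ⟨MoritaContext.Quad.swap (c := c.swap) Q, hQ⟩
    · exact fun ⟨Q, hQ⟩ => ⟨MoritaContext.Quad.swap Q, hQ⟩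
    · exact fun ⟨Q, hQ⟩ => ⟨MoritaContext.Quad.swap (c := c.swap) Q, hQ⟩
    · exact fun ⟨Q, hQ⟩ => ⟨MoritaContext.Quad.swap Q, hQ⟩
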